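/- Let $K\subset\mathbb{R}$ be a real-quadratic number field with ring of integers $\mathcal{O}_K$ and non-trivial automorphism $a\mapsto a'$. For $L\in\mathcal{O}_K^{2\times 2}$ let $L'$ be the entrywise conjugate and $\mathcal{I}(L)$ the ideal generated by the entries of $L$. Define the subgroups $$\Sigma_K=\Big\{\tfrac{1}{\sqrt{\ell}}L:\ \ell\in\mathbb{Z}_{>0},\ L\in\mathcal{O}_K^{2\times2}\Big\}\cap SL_2(\mathbb{R}),$$ $$\Gamma_K^*=\Big\{\tfrac{1}{\sqrt{\det L}}L:\ L\in\mathcal{O}_K^{2\times2},\ \det L>0,\ (\det L)'>0,\ \mathcal{I}(L)^2=\mathcal{O}_K\det L\Big\}$$ (the Hurwitz–Maaß extension) of $SL_2(\mathbb{R})$, and $\Gamma_K=SL_2(\mathcal{O}_K)$. Let $B=(u,v)$ be a $\mathbb{Z}$-basis of $\mathcal{O}_K$ and put $$S=\begin{pmatrix}2uu'&uv'+u'v\\uv'+u'v&2vv'\end{pmatrix},\qquad S_1=\begin{pmatrix}0&0&1\\0&S&0\\1&0&0\end{pmatrix}.$$ Let $SO_0(S_1;\mathbb{R})$ be the identity component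 of $\{U\in SL_4(\mathbb{R}): U^{tr}S_1U=S_1\}$, let $SO_0(S_1;\mathbb{Q})$ and $SO_0(S_1;\mathbb{Z})$ be its subgroups of rational and of integral matrices, and let $\mathcal{D}(S_1;\mathbb{Z})=\{U\in SO_0(S_1;\mathbb{Z}): U\in I+\mathbb{Z}^{4\times4}S_1\}$ be the discriminant kernel. For $M=\frac{1}{\sqrt\ell}L=\begin{pmatrix}\alpha&\beta\\\gamma&\delta\end{pmatrix}\in\Sigma_K$ put $M'=\frac{1}{\sqrt\ell}L'=\begin{pmatrix}\alpha'&\beta'\\\gamma'&\delta'\end{pmatrix}$ (determined by $M$ up to sign; for $M\in\Gamma_K$ take $\ell=1$) and $$\widetilde M=\begin{pmatrix}\alpha\alpha'&a^{tr}S&-\beta\beta'\\ b&E&c\\-\gamma\gamma'&d^{tr}S&\delta\delta'\end{pmatrix},$$ where, with the coordinate map $\varphi_B:K\to\mathbb{Q}^2$, $xu+yv\mapsto(x,y)^{tr}$, one has $a=\varphi_B(-\alpha'\beta)$, $b=\varphi_B(-\alpha\gamma')$, $c=\varphi_B(\beta\delta')$, $d=\varphi_B(\gamma'\delta)$, and $E$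 is the matrix of $w\mapsto\alpha\delta'w+\beta\gamma'w'$ in the basis $B$. Then $\widetilde M=\widehat G^{-1}\Omega(M,M')\widehat G$ with $$\Omega(M,M')=\begin{pmatrix}\alpha FM'F&\beta FM'\\\gamma M'F&\delta M'\end{pmatrix},\quad F=\begin{pmatrix}-1&0\\0&1\end{pmatrix},\quad \widehat G=\begin{pmatrix}1&0&0&0\\0&u&v&0\\0&u'&v'&0\\0&0&0&1\end{pmatrix},$$ one has $\Gamma_K^*\subseteq\Sigma_K$, and the maps $$\Sigma_K/\{\pm I\}\to SO_0(S_1;\mathbb{Q})/\{\pm I\},\qquad \Gamma_K^*/\{\pm I\}\to SO_0(S_1;\mathbb{Z})/\{\pm I\},\qquad \pm M\mapsto\pm\widetilde M,$$ $$\Gamma_K/\{\pm I\}\to\mathcal{D}(S_1;\mathbb{Z}),\qquad \pm M\mapsto\widetilde M,$$ are well-defined isomorphisms of groups. -/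

import Mathlib

open Matrix NumberField

noncomputable section

namespace HilbertOrth

/-! ### The group of signs and orthogonal groups -/

/-- The subgroup consisting of the matrices `I` and `-I` of determinant one. -/
def pmOne (n : ℕ) (R : Type*) [CommRing R] : Subgroup (Matrix.SpecialLinearGroup (Fin n) R) where
  carrier := {U | (U : Matrix (Fin n) (Fin n) R) = 1 ∨ (U : Matrix (Fin n) (Fin n) R) = -1}
  one_mem' := Or.inl rfl
  mul_mem' := by
    rintro U V (hU | hU) (hV | hV) <;> simp [hU, hV]
  inv_mem' := by
    rintro U hU
    have h : (U : Matrix (Fin n) (Fin n) R) * (U⁻¹ : Matrix.SpecialLinearGroup (Fin n) R) = 1 := by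
      rw [← Matrix.SpecialLinearGroup.coe_mul, mul_inv_cancel, Matrix.SpecialLinearGroup.coe_one]
    rcases hU with hU | hU
    · left
      rwa [hU, one_mul] at h
    · right
      rw [hU, neg_mul, one_mul] at h
      exact neg_eq_iff_eq_neg.mp h

instance pmOne_normal (n : ℕ) (R : Type*) [CommRing R] : (pmOne n R).Normal where
  conj_mem := by
    rintro U hU V
    have h : (V : Matrix (Fin n) (Fin n) R) * (V⁻¹ : Matrix.SpecialLinearGroup (Fin n) R) = 1 := by
      rw [← Matrix.SpecialLinearGroup.coe_mul, mul_inv_cancel, Matrix.SpecialLinearGroup.coe_one]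
    rcases hU with hU | hU
    · left
      rw [Matrix.SpecialLinearGroup.coe_mul, Matrix.SpecialLinearGroup.coe_mul, hU, mul_one, h]
    · right
      rw [Matrix.SpecialLinearGroup.coe_mul, Matrix.SpecialLinearGroup.coe_mul, hU, mul_neg, mul_one, neg_mul, h]

/-- For a group `H` of matrices of determinant one, the quotient `H / {± I}`. -/
abbrev ModPm {n : ℕ} {R : Type*} [CommRing R] (H : Subgroup (Matrix.SpecialLinearGroup (Fin n) R)) :
    Type _ :=
  H ⧸ (pmOne n R).subgroupOf H

/-- The special orthogonal group `SO(T; ℝ) = {U ∈ SL_n(ℝ) ; Uᵗ T U = T}`. -/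
def SOReal {n : ℕ} (T : Matrix (Fin n) (Fin n) ℤ) : Subgroup (Matrix.SpecialLinearGroup (Fin n) ℝ) where
  carrier := {U | (U : Matrix (Fin n) (Fin n) ℝ)ᵀ * T.map (Int.cast : ℤ → ℝ) *
    (U : Matrix (Fin n) (Fin n) ℝ) = T.map (Int.cast : ℤ → ℝ)}
  one_mem' := by simp
  mul_mem' := by
    intro U V hU hV
    change _ = _ at hU
    change _ = _ at hV
    change _ = _
    rw [Matrix.SpecialLinearGroup.coe_mul, transpose_mul]
    calc (V : Matrix (Fin n) (Fin n) ℝ)ᵀ * (U : Matrix (Fin n) (Fin n) ℝ)ᵀ *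
          T.map (Int.cast : ℤ → ℝ) * ((U : Matrix (Fin n) (Fin n) ℝ) * V)
        = (V : Matrix (Fin n) (Fin n) ℝ)ᵀ * ((U : Matrix (Fin n) (Fin n) ℝ)ᵀ *
          T.map (Int.cast : ℤ → ℝ) * (U : Matrix (Fin n) (Fin n) ℝ)) * V := by
          simp only [Matrix.mul_assoc]
      _ = _ := by rw [hU, hV]
  inv_mem' := by
    intro U hU
    change _ = _ at hU
    change _ = _
    have h : (U : Matrix (Fin n) (Fin n) ℝ) * (U⁻¹ : Matrix.SpecialLinearGroup (Fin n) ℝ) = 1 := by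
      rw [← Matrix.SpecialLinearGroup.coe_mul, mul_inv_cancel, Matrix.SpecialLinearGroup.coe_one]
    have h' := congrArg Matrix.transpose h
    rw [transpose_mul, transpose_one] at h'
    calc ((U⁻¹ : Matrix.SpecialLinearGroup (Fin n) ℝ) : Matrix (Fin n) (Fin n) ℝ)ᵀ *
          T.map (Int.cast : ℤ → ℝ) * (U⁻¹ : Matrix.SpecialLinearGroup (Fin n) ℝ)
        = ((U⁻¹ : Matrix.SpecialLinearGroup (Fin n) ℝ) : Matrix (Fin n) (Fin n) ℝ)ᵀ *
          ((U : Matrix (Fin n) (Fin n) ℝ)ᵀ * T.map (Int.cast : ℤ → ℝ) *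
            (U : Matrix (Fin n) (Fin n) ℝ)) * (U⁻¹ : Matrix.SpecialLinearGroup (Fin n) ℝ) := by rw [hU]
      _ = (((U⁻¹ : Matrix.SpecialLinearGroup (Fin n) ℝ) : Matrix (Fin n) (Fin n) ℝ)ᵀ *
          (U : Matrix (Fin n) (Fin n) ℝ)ᵀ) * T.map (Int.cast : ℤ → ℝ) *
            ((U : Matrix (Fin n) (Fin n) ℝ) * (U⁻¹ : Matrix.SpecialLinearGroup (Fin n) ℝ)) := by
          simp only [Matrix.mul_assoc]
      _ = _ := by rw [h, h', Matrix.one_mul, Matrix.mul_one]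

/-- `SO_0(T; ℝ)`: the connected component of the identity of `SO(T; ℝ)`. -/
def SO0Real {n : ℕ} (T : Matrix (Fin n) (Fin n) ℤ) : Subgroup (Matrix.SpecialLinearGroup (Fin n) ℝ) :=
  (Subgroup.connectedComponentOfOne (SOReal T)).map (SOReal T).subtype

/-- `SO_0(T; ℚ)`: the rational matrices in `SO_0(T; ℝ)`. -/
def SO0Rat {n : ℕ} (T : Matrix (Fin n) (Fin n) ℤ) : Subgroup (Matrix.SpecialLinearGroup (Fin n) ℚ) :=
  (SO0Real T).comap (Matrix.SpecialLinearGroup.map (algebraMap ℚ ℝ))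

/-- `SO_0(T; ℤ)`: the integral matrices in `SO_0(T; ℝ)`. -/
def SO0Int {n : ℕ} (T : Matrix (Fin n) (Fin n) ℤ) : Subgroup (Matrix.SpecialLinearGroup (Fin n) ℤ) :=
  (SO0Real T).comap (Matrix.SpecialLinearGroup.map (Int.castRingHom ℝ))

/-- The discriminant kernel `{U ∈ SO_0(T; ℤ) ; U ∈ I + ℤ^{n × n} T}`. -/
def discKernel {n : ℕ} (T : Matrix (Fin n) (Fin n) ℤ) : Subgroup (Matrix.SpecialLinearGroup (Fin n) ℤ) where
  carrier := {U | U ∈ SO0Int T ∧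
    ∃ X : Matrix (Fin n) (Fin n) ℤ, (U : Matrix (Fin n) (Fin n) ℤ) = 1 + X * T}
  one_mem' := ⟨one_mem _, 0, by simp⟩
  mul_mem' := by
    rintro U V ⟨hU, X, hX⟩ ⟨hV, Y, hY⟩
    refine ⟨mul_mem hU hV, X + Y + X * T * Y, ?_⟩
    rw [Matrix.SpecialLinearGroup.coe_mul, hX, hY]
    noncomm_ring
  inv_mem' := by
    rintro U ⟨hU, X, hX⟩
    refine ⟨inv_mem hU, -((U⁻¹ : Matrix.SpecialLinearGroup (Fin n) ℤ) : Matrix (Fin n) (Fin n) ℤ) * X, ?_⟩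
    have h : ((U⁻¹ : Matrix.SpecialLinearGroup (Fin n) ℤ) : Matrix (Fin n) (Fin n) ℤ) * U = 1 := by
      rw [← Matrix.SpecialLinearGroup.coe_mul, inv_mul_cancel, Matrix.SpecialLinearGroup.coe_one]
    rw [hX, Matrix.mul_add, Matrix.mul_one, ← Matrix.mul_assoc] at h
    rw [← h, Matrix.neg_mul, Matrix.neg_mul, add_neg_cancel_right]

/-- The orthogonal sum `T_1` of a binary form `T` with the hyperbolic plane. -/
def hyp (T : Matrix (Fin 2) (Fin 2) ℤ) : Matrix (Fin 4) (Fin 4) ℤ :=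
  !![0, 0, 0, 1;
     0, T 0 0, T 0 1, 0;
     0, T 1 0, T 1 1, 0;
     1, 0, 0, 0]

/-- The homomorphism `Ω` on pairs of real two by two matrices: with `F = diag(-1, 1)` the blocks of
`Ω(U, V)` are `α F V F`, `β F V`, `γ V F`, `δ V`, where `α, β, γ, δ` are the entries of `U`. -/
def Omega (U V : Matrix (Fin 2) (Fin 2) ℝ) : Matrix (Fin 4) (Fin 4) ℝ :=
  let F : Matrix (Fin 2) (Fin 2) ℝ := !![-1, 0; 0, 1]
  let W₁ := U 0 0 • (F * V * F)
  let W₂ := U 0 1 • (F * V)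
  let W₃ := U 1 0 • (V * F)
  let W₄ := U 1 1 • V
  !![W₁ 0 0, W₁ 0 1, W₂ 0 0, W₂ 0 1;
     W₁ 1 0, W₁ 1 1, W₂ 1 0, W₂ 1 1;
     W₃ 0 0, W₃ 0 1, W₄ 0 0, W₄ 0 1;
     W₃ 1 0, W₃ 1 1, W₄ 1 0, W₄ 1 1]

/-! ### Groups attached to a quadratic field `K` with a real embedding `ι` -/

section Field

variable {K : Type*} [Field K]

/-- The image of a matrix over the ring of integers under a ring homomorphism `K → ℝ`. -/
def realMat (ι : K →+* ℝ) (L : Matrix (Fin 2) (Fin 2) (𝓞 K)) : Matrix (Fin 2) (Fin 2) ℝ :=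
  L.map fun x => ι (x : K)

/-- `M = (1 / √ℓ) L` with a positive integer `ℓ` and an integral matrix `L` over `K`. -/
def IsRep (ι : K →+* ℝ) (M : Matrix.SpecialLinearGroup (Fin 2) ℝ) (ℓ : ℕ)
    (L : Matrix (Fin 2) (Fin 2) (𝓞 K)) : Prop :=
  0 < ℓ ∧ (M : Matrix (Fin 2) (Fin 2) ℝ) = (1 / √(ℓ : ℝ)) • realMat ι L

lemma realMat_mul (ι : K →+* ℝ) (L N : Matrix (Fin 2) (Fin 2) (𝓞 K)) :
    realMat ι (L * N) = realMat ι L * realMat ι N :=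
  Matrix.map_mul (f := ι.comp (algebraMap (𝓞 K) K))

lemma realMat_adjugate (ι : K →+* ℝ) (L : Matrix (Fin 2) (Fin 2) (𝓞 K)) :
    realMat ι L.adjugate = (realMat ι L).adjugate :=
  RingHom.map_adjugate (ι.comp (algebraMap (𝓞 K) K)) L

lemma realMat_one (ι : K →+* ℝ) :
    realMat ι (1 : Matrix (Fin 2) (Fin 2) (𝓞 K)) = 1 :=
  Matrix.map_one _ (map_zero (ι.comp (algebraMap (𝓞 K) K)))
    (map_one (ι.comp (algebraMap (𝓞 K) K)))

/-- The group `Σ_K` of all `(1 / √ℓ) L` in `SL_2(ℝ)` with `ℓ ≥ 1` an integer and `L` integral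
over `K`. -/
def SigmaGroup (ι : K →+* ℝ) : Subgroup (Matrix.SpecialLinearGroup (Fin 2) ℝ) where
  carrier := {M | ∃ (ℓ : ℕ) (L : Matrix (Fin 2) (Fin 2) (𝓞 K)), IsRep ι M ℓ L}
  one_mem' := ⟨1, 1, one_pos, by simp [realMat_one]⟩
  mul_mem' := by
    rintro M₁ M₂ ⟨ℓ₁, L₁, h₁, e₁⟩ ⟨ℓ₂, L₂, h₂, e₂⟩
    refine ⟨ℓ₁ * ℓ₂, L₁ * L₂, Nat.mul_pos h₁ h₂, ?_⟩
    rw [Matrix.SpecialLinearGroup.coe_mul, e₁, e₂, realMat_mul, smul_mul_smul_comm, Nat.cast_mul,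
      Real.sqrt_mul (Nat.cast_nonneg _), div_mul_div_comm, one_mul]
  inv_mem' := by
    rintro M ⟨ℓ, L, h, e⟩
    refine ⟨ℓ, L.adjugate, h, ?_⟩
    rw [Matrix.SpecialLinearGroup.coe_inv, e, adjugate_smul, realMat_adjugate]
    simp

/-- The ideal `I(L)` of the ring of integers generated by the entries of an integral matrix. -/
def entryIdeal (L : Matrix (Fin 2) (Fin 2) (𝓞 K)) : Ideal (𝓞 K) :=
  Ideal.span (Set.range fun p : Fin 2 × Fin 2 => L p.1 p.2)

lemma entry_mem (L : Matrix (Fin 2) (Fin 2) (𝓞 K)) (i j : Fin 2) : L i j ∈ entryIdeal L :=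
  Ideal.subset_span ⟨(i, j), rfl⟩

lemma entryIdeal_le {L : Matrix (Fin 2) (Fin 2) (𝓞 K)} {I : Ideal (𝓞 K)} :
    entryIdeal L ≤ I ↔ ∀ i j, L i j ∈ I := by
  rw [entryIdeal, Ideal.span_le]
  constructor
  · intro h i j
    exact h ⟨(i, j), rfl⟩
  · rintro h _ ⟨p, rfl⟩
    exact h p.1 p.2

lemma entryIdeal_mul_le (L N : Matrix (Fin 2) (Fin 2) (𝓞 K)) :
    entryIdeal (L * N) ≤ entryIdeal L * entryIdeal N := by
  rw [entryIdeal_le]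
  intro i j
  rw [Matrix.mul_apply]
  exact Ideal.sum_mem _ fun k _ => Ideal.mul_mem_mul (entry_mem L i k) (entry_mem N k j)

lemma entryIdeal_adjugate_le (L : Matrix (Fin 2) (Fin 2) (𝓞 K)) :
    entryIdeal L.adjugate ≤ entryIdeal L := by
  rw [entryIdeal_le, adjugate_fin_two]
  intro i j
  fin_cases i <;> fin_cases j <;> simp [entry_mem]

lemma entryIdeal_adjugate (L : Matrix (Fin 2) (Fin 2) (𝓞 K)) :
    entryIdeal L.adjugate = entryIdeal L := by
  refine le_antisymm (entryIdeal_adjugate_le L) ?_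
  have h : L.adjugate.adjugate = L := by
    simp [adjugate_fin_two, ← Matrix.eta_fin_two]
  calc entryIdeal L = entryIdeal L.adjugate.adjugate := by rw [h]
    _ ≤ entryIdeal L.adjugate := entryIdeal_adjugate_le _

lemma entryIdeal_mul [NumberField K] {L N : Matrix (Fin 2) (Fin 2) (𝓞 K)} (h0 : L.det ≠ 0)
    (hL : entryIdeal L ^ 2 = Ideal.span {L.det}) :
    entryIdeal (L * N) = entryIdeal L * entryIdeal N := by
  refine le_antisymm (entryIdeal_mul_le L N) ?_
  have hne : entryIdeal L ≠ 0 := by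
    intro h
    rw [h, zero_pow two_ne_zero] at hL
    exact h0 (Ideal.span_singleton_eq_bot.mp hL.symm)
  have key : entryIdeal L * (entryIdeal L * entryIdeal N) ≤
      entryIdeal L * entryIdeal (L * N) := by
    rw [← mul_assoc, ← pow_two, hL, Ideal.span_singleton_mul_le_iff]
    have h1 : ∀ z ∈ entryIdeal N, z ∈ Submodule.comap (LinearMap.mulLeft (𝓞 K) L.det)
        (entryIdeal L * entryIdeal (L * N)) := by
      have : entryIdeal N ≤ Submodule.comap (LinearMap.mulLeft (𝓞 K) L.det)
          (entryIdeal L * entryIdeal (L * N)) := by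
        rw [entryIdeal_le]
        intro i j
        have e : L.det * N i j = (L.adjugate * (L * N)) i j := by
          rw [← Matrix.mul_assoc, adjugate_mul, Matrix.smul_mul, Matrix.one_mul,
            Matrix.smul_apply, smul_eq_mul]
        rw [Submodule.mem_comap, LinearMap.mulLeft_apply, e]
        have := entryIdeal_mul_le L.adjugate (L * N) (entry_mem _ i j)
        rwa [entryIdeal_adjugate] at this
      exact fun z hz => this hz
    exact fun z hz => h1 z hz
  rw [← Ideal.dvd_iff_le] at key ⊢
  exact (mul_dvd_mul_iff_left hne).mp key

/-- The Hurwitz-Maass extension `Γ*_K` of the Hilbert modular group: all `(1 / √(det L)) L` with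
`L` integral over `K`, with `det L` totally positive and `I(L)^2` generated by `det L`.
Here `σ` is the non-trivial automorphism of `K`. -/
def HurwitzMaass [NumberField K] (ι : K →+* ℝ) (σ : K ≃ₐ[ℚ] K) : Subgroup (Matrix.SpecialLinearGroup (Fin 2) ℝ) where
  carrier := {M | ∃ L : Matrix (Fin 2) (Fin 2) (𝓞 K),
    0 < ι (L.det : K) ∧ 0 < ι (σ (L.det : K)) ∧ entryIdeal L ^ 2 = Ideal.span {L.det} ∧
    (M : Matrix (Fin 2) (Fin 2) ℝ) = (1 / √(ι (L.det : K))) • realMat ι L}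
  one_mem' := ⟨1, by simp, by simp, by
    have : entryIdeal (1 : Matrix (Fin 2) (Fin 2) (𝓞 K)) = ⊤ := by
      rw [Ideal.eq_top_iff_one]
      simpa using entry_mem (1 : Matrix (Fin 2) (Fin 2) (𝓞 K)) 0 0
    rw [this, det_one, Ideal.span_singleton_one, Ideal.top_pow], by simp [realMat_one]⟩
  mul_mem' := by
    rintro M₁ M₂ ⟨L₁, p₁, q₁, i₁, e₁⟩ ⟨L₂, p₂, q₂, i₂, e₂⟩
    have h0 : L₁.det ≠ 0 := by
      intro h
      rw [h] at p₁
      simp at p₁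
    have hc : ((L₁ * L₂).det : K) = (L₁.det : K) * (L₂.det : K) := by
      rw [det_mul]
      exact map_mul (algebraMap (𝓞 K) K) _ _
    refine ⟨L₁ * L₂, ?_, ?_, ?_, ?_⟩
    · rw [hc, map_mul]
      exact mul_pos p₁ p₂
    · rw [hc, map_mul, map_mul]
      exact mul_pos q₁ q₂
    · rw [entryIdeal_mul h0 i₁, mul_pow, i₁, i₂, Ideal.span_singleton_mul_span_singleton, det_mul]
    · rw [Matrix.SpecialLinearGroup.coe_mul, e₁, e₂, realMat_mul, smul_mul_smul_comm, hc, map_mul,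
        Real.sqrt_mul p₁.le, div_mul_div_comm, one_mul]
  inv_mem' := by
    rintro M ⟨L, p, q, i, e⟩
    have hd : L.adjugate.det = L.det := by simp [det_adjugate]
    refine ⟨L.adjugate, ?_, ?_, ?_, ?_⟩
    · rwa [hd]
    · rwa [hd]
    · rw [hd, entryIdeal_adjugate, i]
    · rw [Matrix.SpecialLinearGroup.coe_inv, e, adjugate_smul, realMat_adjugate, hd]
      simp

/-! ### The map `M ↦ M̃` -/

variable [NumberField K]

/-- The Gram matrix `S` of a `ℤ`-basis `B` of the ring of integers for the even symmetric bilinear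
form `(x, y) ↦ x y' + x' y = Tr(x y')`, where `y' = σ y`. -/
def gram (σ : K ≃ₐ[ℚ] K) (B : Module.Basis (Fin 2) ℤ (𝓞 K)) : Matrix (Fin 2) (Fin 2) ℤ :=
  Matrix.of fun i j =>
    Algebra.trace ℤ (𝓞 K) (B i * RingOfIntegers.mapRingEquiv (σ : K ≃+* K) (B j))

/-- The basis `B` as a basis of `K` over `ℚ`. -/
def ratBasis (B : Module.Basis (Fin 2) ℤ (𝓞 K)) : Module.Basis (Fin 2) ℚ K :=
  B.localizationLocalization ℚ (nonZeroDivisors ℤ) K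

/-- The coordinate map `φ_B : K → ℚ²`. -/
def coords (B : Module.Basis (Fin 2) ℤ (𝓞 K)) (x : K) : Fin 2 → ℚ :=
  fun i => (ratBasis B).repr x i

/-- The matrix, in the basis `B`, of the endomorphism `w ↦ p w + q w'` of `K`. -/
def endoMat (σ : K ≃ₐ[ℚ] K) (B : Module.Basis (Fin 2) ℤ (𝓞 K)) (p q : K) :
    Matrix (Fin 2) (Fin 2) ℚ :=
  LinearMap.toMatrix (ratBasis B) (ratBasis B)
    (LinearMap.mulLeft ℚ p + LinearMap.mulLeft ℚ q ∘ₗ σ.toLinearMap)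

/-- The matrix `M̃` attached to `M = (1 / √ℓ) L`. If `α, β, γ, δ` are the entries of `M`, a product
such as `α β'` equals `L₀₀ L₀₁' / ℓ`, and `α α'` is the norm of `L₀₀` divided by `ℓ`. -/
def tildeMat (σ : K ≃ₐ[ℚ] K) (B : Module.Basis (Fin 2) ℤ (𝓞 K)) (ℓ : ℕ)
    (L : Matrix (Fin 2) (Fin 2) (𝓞 K)) : Matrix (Fin 4) (Fin 4) ℚ :=
  let S : Matrix (Fin 2) (Fin 2) ℚ := (gram σ B).map (Int.cast : ℤ → ℚ)
  let m : 𝓞 K → 𝓞 K → K := fun x y => (x : K) * σ (y : K) / (ℓ : K)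
  let nm : 𝓞 K → ℚ := fun x => Algebra.norm ℚ (x : K) / (ℓ : ℚ)
  let α := L 0 0
  let β := L 0 1
  let γ := L 1 0
  let δ := L 1 1
  let a := coords B (-m β α)
  let b := coords B (-m α γ)
  let c := coords B (m β δ)
  let d := coords B (m δ γ)
  let E := endoMat σ B (m α δ) (m β γ)
  !![nm α, (a ᵥ* S) 0, (a ᵥ* S) 1, -nm β;
     b 0, E 0 0, E 0 1, c 0;
     b 1, E 1 0, E 1 1, c 1;
     -nm γ, (d ᵥ* S) 0, (d ᵥ* S) 1, nm δ]

/-- The base change matrix `Ĝ = diag(1, G, 1)` with `G` having rows `(u, v)` and `(u', v')`, for the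
basis `B = (u, v)`. -/
def hatG (ι : K →+* ℝ) (σ : K ≃ₐ[ℚ] K) (B : Module.Basis (Fin 2) ℤ (𝓞 K)) :
    Matrix (Fin 4) (Fin 4) ℝ :=
  !![1, 0, 0, 0;
     0, ι (B 0 : K), ι (B 1 : K), 0;
     0, ι (σ (B 0 : K)), ι (σ (B 1 : K)), 0;
     0, 0, 0, 1]

end Field

end HilbertOrth

end

open Matrix NumberField HilbertOrth

namespace HilbertOrth

/-! ### Twisted tensor products of two by two matrices -/

/-! After base change by Ĝ a rational vector (x₀, w, x₃), with w in K, becomes the matrix X with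
rows (-x₀, w) and (w', x₃). These are the X equal to their conjugate transpose, and the form `S₁`
becomes -2 det X. The matrix M̃ is the action X ↦ M X M'ᵗʳ, written in coordinates as `tens M M'`;
so M̃ preserves the form and is multiplicative in M.

Surjectivity over ℚ: by `exists_tens`, an isometry of the split form of determinant one over a field
with 2 ≠ 0 is `tens A C` with det A · det C = 1. Applied over K to a rational U, Galois invariance
interchanges the two factors, and their uniqueness up to scalars gives C = c A' with c rational
(`exists_conj_factor`). The identity component is detected by the sign of det C: `blockDet` is a
polynomial in the isometry whose value on `tens A C` is a sum of squares times det C, so over ℝ it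
never vanishes on the special orthogonal group (`blockDet_pos`). Conversely SL₂(ℝ) × SL₂(ℝ) is
connected. Since c det A has norm one, Hilbert 90 rescales A to an integral L whose determinant is a
positive integer ℓ (`exists_isRep_of_mem_SO0Rat`).

Integrality: the bridge is `ConjDvd`, which says I(L) I(L)' ⊆ (ℓ). For det L = ℓ it is equivalent to
I(L)² = (ℓ) by ideal arithmetic, and to integrality of M̃.

Discriminant kernel: for det L = 1 a trace identity writes M̃ - I as a multiple of `S₁`. Conversely,
membership yields one more divisibility by ℓ, which together with I(L)² = (ℓ) forces ℓ = 1 when L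
has no integer factor (`eq_one_of_primitive`); such factors are removed by induction on ℓ.

The pair (ℓ, L) is not determined by M: L = √D · I with ℓ = D represents ±I, yet its M̃ is -I. The
isomorphisms are therefore built from multiplicative relations (`exists_mulEquiv_of_rel`). -/

/-- The twisted tensor product of two matrices of size two: the conjugate of the Kronecker product
by `diag(-1, 1, 1, 1)`. -/
def tens {R : Type*} [CommRing R] (A B : Matrix (Fin 2) (Fin 2) R) : Matrix (Fin 4) (Fin 4) R :=
  !![A 0 0 * B 0 0, -(A 0 0 * B 0 1), -(A 0 1 * B 0 0), -(A 0 1 * B 0 1);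
     -(A 0 0 * B 1 0), A 0 0 * B 1 1, A 0 1 * B 1 0, A 0 1 * B 1 1;
     -(A 1 0 * B 0 0), A 1 0 * B 0 1, A 1 1 * B 0 0, A 1 1 * B 0 1;
     -(A 1 0 * B 1 0), A 1 0 * B 1 1, A 1 1 * B 1 0, A 1 1 * B 1 1]

/-- The split symmetric bilinear form of rank four. -/
def splitForm (R : Type*) [CommRing R] : Matrix (Fin 4) (Fin 4) R :=
  !![0, 0, 0, 1; 0, 0, 1, 0; 0, 1, 0, 0; 1, 0, 0, 0]

/-- The alternating sum of the determinants of the four blocks of size two. -/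
def blockDet {R : Type*} [CommRing R] (T : Matrix (Fin 4) (Fin 4) R) : R :=
  (T 0 0 * T 1 1 - T 0 1 * T 1 0) - (T 0 2 * T 1 3 - T 0 3 * T 1 2) -
    (T 2 0 * T 3 1 - T 2 1 * T 3 0) + (T 2 2 * T 3 3 - T 2 3 * T 3 2)

section CommRing

variable {R : Type*} [CommRing R]

lemma Omega_eq_tens (A B : Matrix (Fin 2) (Fin 2) ℝ) : Omega A B = tens A B := by
  ext i j
  fin_cases i <;> fin_cases j <;>
    simp [Omega, tens, Matrix.mul_apply, Fin.sum_univ_two, Matrix.vecMul, dotProduct]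

lemma tens_mul (A B C D : Matrix (Fin 2) (Fin 2) R) :
    tens A B * tens C D = tens (A * C) (B * D) := by
  ext i j
  fin_cases i <;> fin_cases j <;>
    simp [tens, Matrix.mul_apply, Fin.sum_univ_succ] <;> ring

lemma tens_one : tens (1 : Matrix (Fin 2) (Fin 2) R) 1 = 1 := by
  ext i j
  fin_cases i <;> fin_cases j <;> simp [tens]

lemma tens_smul (r s : R) (A B : Matrix (Fin 2) (Fin 2) R) :
    tens (r • A) (s • B) = (r * s) • tens A B := by
  ext i j
  fin_cases i <;> fin_cases j <;> simp [tens] <;> ring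

lemma tens_map {R' : Type*} [CommRing R'] (f : R →+* R') (A B : Matrix (Fin 2) (Fin 2) R) :
    (tens A B).map f = tens (A.map f) (B.map f) := by
  ext i j
  fin_cases i <;> fin_cases j <;> simp [tens]

lemma det_fin_four (A : Matrix (Fin 4) (Fin 4) R) :
    A.det = A 0 0 * (A 1 1 * (A 2 2 * A 3 3 - A 2 3 * A 3 2) - A 1 2 * (A 2 1 * A 3 3 - A 2 3 * A 3 1)
        + A 1 3 * (A 2 1 * A 3 2 - A 2 2 * A 3 1))
      - A 0 1 * (A 1 0 * (A 2 2 * A 3 3 - A 2 3 * A 3 2) - A 1 2 * (A 2 0 * A 3 3 - A 2 3 * A 3 0)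
        + A 1 3 * (A 2 0 * A 3 2 - A 2 2 * A 3 0))
      + A 0 2 * (A 1 0 * (A 2 1 * A 3 3 - A 2 3 * A 3 1) - A 1 1 * (A 2 0 * A 3 3 - A 2 3 * A 3 0)
        + A 1 3 * (A 2 0 * A 3 1 - A 2 1 * A 3 0))
      - A 0 3 * (A 1 0 * (A 2 1 * A 3 2 - A 2 2 * A 3 1) - A 1 1 * (A 2 0 * A 3 2 - A 2 2 * A 3 0)
        + A 1 2 * (A 2 0 * A 3 1 - A 2 1 * A 3 0)) := by
  rw [det_succ_row_zero]
  simp only [Fin.sum_univ_four, det_fin_three, submatrix_apply]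
  simp [Fin.succAbove, Fin.lt_def, Fin.succ, Fin.castSucc]
  ring

lemma det_tens (A B : Matrix (Fin 2) (Fin 2) R) : (tens A B).det = (A.det * B.det) ^ 2 := by
  rw [det_fin_four, det_fin_two, det_fin_two]
  simp [tens]
  ring

/-- Flip the sign of the first coordinate and read the four coordinates as a matrix X. The split
form is then -2 det X and `tens A B` acts by X ↦ A X Bᵗʳ. -/
lemma tens_form (A B : Matrix (Fin 2) (Fin 2) R) :
    (tens A B)ᵀ * splitForm R * tens A B = (A.det * B.det) • splitForm R := by
  ext i j
  fin_cases i <;> fin_cases j <;>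
    simp [tens, splitForm, Matrix.mul_apply, Fin.sum_univ_succ, det_fin_two] <;> ring

/-- Over ℝ the first factor is positive for A ≠ 0, so the sign of det B can be read off continuously
from the product alone. -/
lemma blockDet_tens (A B : Matrix (Fin 2) (Fin 2) R) :
    blockDet (tens A B) = (A 0 0 ^ 2 + A 0 1 ^ 2 + A 1 0 ^ 2 + A 1 1 ^ 2) * B.det := by
  simp [blockDet, tens, det_fin_two]
  ring

end CommRing

/-! ### Factoring isometries of the split form over a field -/

section Field

variable {F : Type*} [Field F]

/-- A singular matrix of size two is an outer product. This factors the isotropic columns of an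
isometry. -/
lemma exists_rank_one (y₀ y₁ y₂ y₃ : F) (h : y₀ * y₃ = y₁ * y₂) :
    ∃ a₀ a₁ b₀ b₁ : F, y₀ = a₀ * b₀ ∧ y₁ = a₀ * b₁ ∧ y₂ = a₁ * b₀ ∧ y₃ = a₁ * b₁ := by
  by_cases h₀ : y₀ = 0
  · by_cases h₁ : y₁ = 0
    · exact ⟨0, 1, y₂, y₃, by simp [h₀], by simp [h₁], by simp, by simp⟩
    · refine ⟨1, y₃ / y₁, y₀, y₁, by simp, by simp, ?_, by field_simp⟩
      have : y₁ * y₂ = 0 := by rw [← h, h₀, zero_mul]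
      simp [(mul_eq_zero.mp this).resolve_left h₁, h₀]
  · refine ⟨1, y₂ / y₀, y₀, y₁, by simp, by simp, by field_simp, ?_⟩
    field_simp
    linear_combination h

/-- A matrix of determinant one which preserves the split form is a twisted tensor product. -/
theorem exists_tens (h2 : (2 : F) ≠ 0) (T : Matrix (Fin 4) (Fin 4) F)
    (hT : Tᵀ * splitForm F * T = splitForm F) (hd : T.det = 1) :
    ∃ A B : Matrix (Fin 2) (Fin 2) F, A.det * B.det = 1 ∧ T = tens A B := by
  have bil : ∀ (V : Matrix (Fin 4) (Fin 4) F), Vᵀ * splitForm F * V = splitForm F → ∀ i j,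
      V 0 i * V 3 j + V 1 i * V 2 j + V 2 i * V 1 j + V 3 i * V 0 j = splitForm F i j := by
    intro V hV i j
    rw [← congrFun (congrFun hV i) j]
    simp [splitForm, Matrix.mul_apply, Fin.sum_univ_succ]
    ring
  -- The first and last columns of T are isotropic; with the signs of the twist they are singular
  -- matrices of size two, hence outer products.
  obtain ⟨a₀, a₁, b₀, b₁, e₀, e₁, e₂, e₃⟩ := exists_rank_one (T 0 0) (-T 1 0) (-T 2 0) (-T 3 0) (by
    have := bil T hT 0 0
    simp [splitForm] at this
    have h : (2 : F) * (T 0 0 * T 3 0 + T 1 0 * T 2 0) = 0 := by linear_combination this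
    linear_combination -(mul_eq_zero.mp h).resolve_left h2)
  obtain ⟨c₀, c₁, d₀, d₁, f₀, f₁, f₂, f₃⟩ := exists_rank_one (-T 0 3) (T 1 3) (T 2 3) (T 3 3) (by
    have := bil T hT 3 3
    simp [splitForm] at this
    have h : (2 : F) * (T 0 3 * T 3 3 + T 1 3 * T 2 3) = 0 := by linear_combination this
    linear_combination -(mul_eq_zero.mp h).resolve_left h2)
  -- With this choice `tens A B` has the same first and last columns as T.
  set A : Matrix (Fin 2) (Fin 2) F := !![a₀, c₀; a₁, c₁] with hA
  set B : Matrix (Fin 2) (Fin 2) F := !![b₀, d₀; b₁, d₁] with hB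
  rw [neg_eq_iff_eq_neg] at e₁ e₂ e₃ f₀
  have hAB : A.det * B.det = 1 := by
    have := bil T hT 0 3
    simp [splitForm] at this
    rw [det_fin_two, det_fin_two]
    simp [hA, hB]
    rw [e₀, f₃, e₁, e₂, e₃, f₁, f₂, f₀] at this
    linear_combination this
  -- As det A · det B = 1, the adjugates give the inverse of `tens A B`. Thus W fixes the first and
  -- last basis vectors, and only an isometry of the middle hyperbolic plane is left.
  set W := tens A.adjugate B.adjugate * T with hW
  have hTW : T = tens A B * W := by
    rw [hW, ← Matrix.mul_assoc, tens_mul, mul_adjugate, mul_adjugate, tens_smul, hAB, one_smul,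
      tens_one, Matrix.one_mul]
  have hWf : Wᵀ * splitForm F * W = splitForm F := by
    have := tens_form A.adjugate B.adjugate
    rw [det_adjugate, det_adjugate] at this
    simp only [Fintype.card_fin, Nat.add_one_sub_one, pow_one, hAB, one_smul] at this
    calc Wᵀ * splitForm F * W = Tᵀ * ((tens A.adjugate B.adjugate)ᵀ * splitForm F *
          tens A.adjugate B.adjugate) * T := by
          rw [hW, transpose_mul]
          simp only [Matrix.mul_assoc]
      _ = _ := by rw [this, hT]
  have hWd : W.det = 1 := by
    have := det_tens A.adjugate B.adjugate
    rw [det_adjugate, det_adjugate] at this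
    rw [hW, det_mul, this, hd]
    simp [hAB]
  have hAB' := hAB
  rw [det_fin_two, det_fin_two] at hAB'
  simp [hA, hB] at hAB'
  have c00 : W 0 0 = 1 := by
    rw [hW, hA, hB, adjugate_fin_two, adjugate_fin_two]
    simp [tens, Matrix.mul_apply, Fin.sum_univ_succ, e₀, e₁, e₂, e₃]
    linear_combination hAB'
  have c10 : W 1 0 = 0 := by
    rw [hW, hA, hB, adjugate_fin_two, adjugate_fin_two]
    simp [tens, Matrix.mul_apply, Fin.sum_univ_succ, e₀, e₁, e₂, e₃]
    ring
  have c20 : W 2 0 = 0 := by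
    rw [hW, hA, hB, adjugate_fin_two, adjugate_fin_two]
    simp [tens, Matrix.mul_apply, Fin.sum_univ_succ, e₀, e₁, e₂, e₃]
    ring
  have c30 : W 3 0 = 0 := by
    rw [hW, hA, hB, adjugate_fin_two, adjugate_fin_two]
    simp [tens, Matrix.mul_apply, Fin.sum_univ_succ, e₀, e₁, e₂, e₃]
    ring
  have c03 : W 0 3 = 0 := by
    rw [hW, hA, hB, adjugate_fin_two, adjugate_fin_two]
    simp [tens, Matrix.mul_apply, Fin.sum_univ_succ, f₀, f₁, f₂, f₃]
    ring
  have c13 : W 1 3 = 0 := by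
    rw [hW, hA, hB, adjugate_fin_two, adjugate_fin_two]
    simp [tens, Matrix.mul_apply, Fin.sum_univ_succ, f₀, f₁, f₂, f₃]
    ring
  have c23 : W 2 3 = 0 := by
    rw [hW, hA, hB, adjugate_fin_two, adjugate_fin_two]
    simp [tens, Matrix.mul_apply, Fin.sum_univ_succ, f₀, f₁, f₂, f₃]
    ring
  have c33 : W 3 3 = 1 := by
    rw [hW, hA, hB, adjugate_fin_two, adjugate_fin_two]
    simp [tens, Matrix.mul_apply, Fin.sum_univ_succ, f₀, f₁, f₂, f₃]
    linear_combination hAB'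
  have r01 := bil W hWf 3 1
  have r02 := bil W hWf 3 2
  have r31 := bil W hWf 0 1
  have r32 := bil W hWf 0 2
  have q11 := bil W hWf 1 1
  have q22 := bil W hWf 2 2
  have q12 := bil W hWf 1 2
  simp [splitForm, c00, c10, c20, c30, c03, c13, c23, c33] at r01 r02 r31 r32 q11 q22 q12
  rw [det_fin_four] at hWd
  simp [c00, c10, c20, c30, c03, c13, c23, c33, r01, r02, r31, r32] at hWd q11 q22 q12
  -- The form gives W₁₁W₂₂ + W₁₂W₂₁ = 1 and the determinant gives W₁₁W₂₂ - W₁₂W₂₁ = 1. This rules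
  -- out the exchange of the two isotropic lines, so W is diagonal.
  have hz : W 2 1 * W 1 2 = 0 := by
    have : (2 : F) * (W 2 1 * W 1 2) = 0 := by linear_combination q12 - hWd
    exact (mul_eq_zero.mp this).resolve_left h2
  have ht : W 1 1 * W 2 2 = 1 := by linear_combination hWd + hz
  have h11 : W 1 1 ≠ 0 := left_ne_zero_of_mul_eq_one ht
  have h22 : W 2 2 ≠ 0 := right_ne_zero_of_mul_eq_one ht
  have h21 : W 2 1 = 0 := by
    have : (2 : F) * (W 1 1 * W 2 1) = 0 := by linear_combination q11
    exact (mul_eq_zero.mp ((mul_eq_zero.mp this).resolve_left h2)).resolve_left h11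
  have h12 : W 1 2 = 0 := by
    have : (2 : F) * (W 2 2 * W 1 2) = 0 := by linear_combination q22
    exact (mul_eq_zero.mp ((mul_eq_zero.mp this).resolve_left h2)).resolve_left h22
  have hWt : W = tens !![1, 0; 0, W 2 2] !![1, 0; 0, W 1 1] := by
    ext i j
    fin_cases i <;> fin_cases j <;>
      simp [tens, c00, c10, c20, c30, c03, c13, c23, c33, r01, r02, r31, r32, h21, h12]
    linear_combination -ht
  refine ⟨A * !![1, 0; 0, W 2 2], B * !![1, 0; 0, W 1 1], ?_, ?_⟩
  · rw [det_mul, det_mul, det_fin_two_of 1 0 0 (W 2 2), det_fin_two_of 1 0 0 (W 1 1)]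
    linear_combination (W 1 1 * W 2 2) * hAB + ht
  · rw [← tens_mul, ← hWt, hTW]

/-- Two nonzero twisted tensor products agree only if the factors are proportional. -/
lemma exists_smul_of_tens_eq {A B C D : Matrix (Fin 2) (Fin 2) F} (h : tens A B = tens C D)
    (hA : A ≠ 0) : ∃ c : F, B = c • D := by
  obtain ⟨k, l, hkl⟩ : ∃ k l, A k l ≠ 0 := by
    by_contra! h'
    exact hA (by ext i j; exact h' i j)
  -- Up to a common sign, each entry of `tens` is a single product of an entry of each factor.
  have key : ∀ i j, A k l * B i j = C k l * D i j := by
    have e : ∀ p q, tens A B p q = tens C D p q := fun p q => by rw [h]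
    have e00 := e 0 0
    have e01 := e 0 1
    have e02 := e 0 2
    have e03 := e 0 3
    have e10 := e 1 0
    have e11 := e 1 1
    have e12 := e 1 2
    have e13 := e 1 3
    have e20 := e 2 0
    have e21 := e 2 1
    have e22 := e 2 2
    have e23 := e 2 3
    have e30 := e 3 0
    have e31 := e 3 1
    have e32 := e 3 2
    have e33 := e 3 3
    simp [tens] at e00 e01 e02 e03 e10 e11 e12 e13 e20 e21 e22 e23 e30 e31 e32 e33
    clear hkl
    fin_cases k <;> fin_cases l <;> intro i j <;> fin_cases i <;> fin_cases j <;> assumption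
  refine ⟨C k l / A k l, ?_⟩
  ext i j
  rw [Matrix.smul_apply, smul_eq_mul, div_mul_eq_mul_div, ← key, mul_div_cancel_left₀ _ hkl]

end Field

/-- A multiplicative relation between two groups which is total on both sides and respects two normal
subgroups induces an isomorphism of the quotient groups. -/
theorem exists_mulEquiv_of_rel {G H : Type*} [Group G] [Group H] (N : Subgroup G) [N.Normal]
    (P : Subgroup H) [P.Normal] (r : G → H → Prop) (tot : ∀ a, ∃ b, r a b) (surj : ∀ b, ∃ a, r a b)
    (mul : ∀ a b c d, r a b → r c d → r (a * c) (b * d)) (hN : ∀ a b, r a b → (a ∈ N ↔ b ∈ P)) :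
    ∃ φ : G ⧸ N ≃* H ⧸ P, ∀ a b, r a b → φ (QuotientGroup.mk a) = QuotientGroup.mk b := by
  -- If c is related to a⁻¹, then c b and c b' are both related to 1 and so lie in P, whence b and
  -- b' agree modulo P.
  have uniq : ∀ a b b', r a b → r a b' → (QuotientGroup.mk b : H ⧸ P) = QuotientGroup.mk b' := by
    intro a b b' h h'
    obtain ⟨c, hc⟩ := tot a⁻¹
    have h₁ := (hN _ _ (mul _ _ _ _ hc h)).mp (by simp)
    have h₂ := (hN _ _ (mul _ _ _ _ hc h')).mp (by simp)
    rw [QuotientGroup.eq]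
    have := P.mul_mem (P.inv_mem h₁) h₂
    simpa [mul_assoc] using this
  choose f hf using tot
  let f' : G →* H ⧸ P := MonoidHom.mk' (fun a => QuotientGroup.mk (f a)) (by
    intro a b
    exact uniq _ _ _ (hf _) (mul _ _ _ _ (hf a) (hf b)))
  have hf' : ∀ a b, r a b → f' a = QuotientGroup.mk b := fun a b h => uniq _ _ _ (hf a) h
  have hs : Function.Surjective f' := by
    intro q
    obtain ⟨b, rfl⟩ := QuotientGroup.mk_surjective q
    obtain ⟨a, ha⟩ := surj b
    exact ⟨a, hf' a b ha⟩
  have hk : N = f'.ker := by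
    ext a
    rw [MonoidHom.mem_ker, hN a _ (hf a)]
    exact (QuotientGroup.eq_one_iff (N := P) (f a)).symm
  exact ⟨(QuotientGroup.quotientMulEquivOfEq hk).trans
    (QuotientGroup.quotientKerEquivOfSurjective f' hs), fun a b h => hf' a b h⟩

/-! ### The identity component of the special orthogonal group -/

/-- Transvections generate SL₂(ℝ), and each is joined to 1 by shrinking its parameter; the component
of 1 is a subgroup. -/
instance connectedSpace_SL2 : ConnectedSpace (Matrix.SpecialLinearGroup (Fin 2) ℝ) := by
  rw [connectedSpace_iff_univ]
  refine ⟨Set.univ_nonempty, ?_⟩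
  have h : connectedComponent (1 : Matrix.SpecialLinearGroup (Fin 2) ℝ) =
      Set.univ := by
    rw [Set.eq_univ_iff_forall]
    refine SL2.transvection_induction _ ?_ fun A B hA hB => (Subgroup.connectedComponentOfOne (Matrix.SpecialLinearGroup (Fin 2) ℝ)).mul_mem hA hB
    intro i j hij c
    have hc : Continuous fun t : ℝ => (SpecialLinearGroup.transvection hij t) := by
      refine Continuous.subtype_mk ?_ _
      change Continuous fun t : ℝ => (1 : Matrix (Fin 2) (Fin 2) ℝ) + single i j t
      refine continuous_const.add ?_
      refine continuous_matrix fun a b => ?_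
      change Continuous fun t : ℝ => if i = a ∧ j = b then t else 0
      split_ifs <;> fun_prop
    have := (isPreconnected_univ.image _ hc.continuousOn).subset_connectedComponent
      (x := (1 : Matrix.SpecialLinearGroup (Fin 2) ℝ)) ⟨0, trivial, by simp⟩
    exact this ⟨c, trivial, rfl⟩
  rw [← h]
  exact isPreconnected_connectedComponent

variable {T : Matrix (Fin 4) (Fin 4) ℤ} {G : Matrix (Fin 4) (Fin 4) ℝ}

lemma mem_SOReal_iff (hG : IsUnit G.det) (hT : Gᵀ * splitForm ℝ * G = T.map (Int.cast : ℤ → ℝ))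
    (U : Matrix.SpecialLinearGroup (Fin 4) ℝ) :
    U ∈ SOReal T ↔ (G * U.1 * G⁻¹)ᵀ * splitForm ℝ * (G * U.1 * G⁻¹) = splitForm ℝ := by
  have h₁ : G * G⁻¹ = 1 := mul_nonsing_inv G hG
  have h₂ : G⁻¹ * G = 1 := nonsing_inv_mul G hG
  have h₃ : Gᵀ * (G⁻¹)ᵀ = 1 := by rw [← transpose_mul, h₂, transpose_one]
  have h₄ : (G⁻¹)ᵀ * Gᵀ = 1 := by rw [← transpose_mul, h₁, transpose_one]
  have e : (G * U.1 * G⁻¹)ᵀ * splitForm ℝ * (G * U.1 * G⁻¹) =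
      (G⁻¹)ᵀ * ((U : Matrix (Fin 4) (Fin 4) ℝ)ᵀ * T.map (Int.cast : ℤ → ℝ) * U) * G⁻¹ := by
    rw [← hT, transpose_mul, transpose_mul]
    simp only [Matrix.mul_assoc]
  have e' : splitForm ℝ = (G⁻¹)ᵀ * T.map (Int.cast : ℤ → ℝ) * G⁻¹ := by
    calc splitForm ℝ = ((G⁻¹)ᵀ * Gᵀ) * splitForm ℝ * (G * G⁻¹) := by
          rw [h₁, h₄, Matrix.one_mul, Matrix.mul_one]
      _ = _ := by
          rw [← hT]
          simp only [Matrix.mul_assoc]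
  have canc : ∀ X Y : Matrix (Fin 4) (Fin 4) ℝ, (G⁻¹)ᵀ * X * G⁻¹ = (G⁻¹)ᵀ * Y * G⁻¹ → X = Y := by
    intro X Y h
    have := congrArg (fun Z => Gᵀ * Z * G) h
    simpa only [Matrix.mul_assoc, h₂, Matrix.mul_one, ← Matrix.mul_assoc Gᵀ, h₃, Matrix.one_mul]
      using this
  change _ = _ ↔ _
  rw [e, e']
  constructor
  · intro h
    rw [h]
  · exact canc _ _

lemma det_conj (hG : IsUnit G.det) (U : Matrix.SpecialLinearGroup (Fin 4) ℝ) :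
    (G * U.1 * G⁻¹).det = 1 := by
  rw [det_mul, det_mul, U.det_coe, mul_one, ← det_mul, mul_nonsing_inv G hG, det_one]

/-- The conjugate of a twisted tensor product of matrices of determinant one lies in the identity
component. -/
lemma mem_SO0Real_of_tens (hG : IsUnit G.det)
    (hT : Gᵀ * splitForm ℝ * G = T.map (Int.cast : ℤ → ℝ))
    (A B : Matrix.SpecialLinearGroup (Fin 2) ℝ) (U : Matrix.SpecialLinearGroup (Fin 4) ℝ)
    (hU : G * U = tens (A : Matrix (Fin 2) (Fin 2) ℝ) B * G) : U ∈ SO0Real T := by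
  have h₁ : G * G⁻¹ = 1 := mul_nonsing_inv G hG
  have h₂ : G⁻¹ * G = 1 := nonsing_inv_mul G hG
  have hd : ∀ p : Matrix.SpecialLinearGroup (Fin 2) ℝ × Matrix.SpecialLinearGroup (Fin 2) ℝ,
      (G⁻¹ * tens (p.1 : Matrix (Fin 2) (Fin 2) ℝ) p.2 * G).det = 1 := by
    intro p
    rw [det_mul, det_mul, det_tens, p.1.det_coe, p.2.det_coe, one_mul, one_pow, mul_one, ← det_mul,
      h₂, det_one]
  have hc : ∀ p : Matrix.SpecialLinearGroup (Fin 2) ℝ × Matrix.SpecialLinearGroup (Fin 2) ℝ,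
      (⟨_, hd p⟩ : Matrix.SpecialLinearGroup (Fin 4) ℝ) ∈ SOReal T := by
    intro p
    refine (mem_SOReal_iff hG hT _).mpr ?_
    have : G * (G⁻¹ * tens (p.1 : Matrix (Fin 2) (Fin 2) ℝ) p.2 * G) * G⁻¹ =
        tens (p.1 : Matrix (Fin 2) (Fin 2) ℝ) p.2 := by
      rw [Matrix.mul_assoc, Matrix.mul_assoc, h₁, Matrix.mul_one, ← Matrix.mul_assoc, h₁,
        Matrix.one_mul]
    change (G * (G⁻¹ * tens (p.1 : Matrix (Fin 2) (Fin 2) ℝ) p.2 * G) * G⁻¹)ᵀ * _ * _ = _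
    rw [this, tens_form, p.1.det_coe, p.2.det_coe, one_mul, one_smul]
  have hcont : Continuous fun p : Matrix.SpecialLinearGroup (Fin 2) ℝ ×
      Matrix.SpecialLinearGroup (Fin 2) ℝ => (⟨⟨_, hd p⟩, hc p⟩ : SOReal T) := by
    refine Continuous.subtype_mk (Continuous.subtype_mk ?_ _) _
    have ht : Continuous fun p : Matrix.SpecialLinearGroup (Fin 2) ℝ ×
        Matrix.SpecialLinearGroup (Fin 2) ℝ => tens (p.1 : Matrix (Fin 2) (Fin 2) ℝ) p.2 := by
      have e₁ : ∀ i j, Continuous fun p : Matrix.SpecialLinearGroup (Fin 2) ℝ ×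
          Matrix.SpecialLinearGroup (Fin 2) ℝ => p.1 i j := fun i j =>
        (continuous_subtype_val.comp continuous_fst).matrix_elem i j
      have e₂ : ∀ i j, Continuous fun p : Matrix.SpecialLinearGroup (Fin 2) ℝ ×
          Matrix.SpecialLinearGroup (Fin 2) ℝ => p.2 i j := fun i j =>
        (continuous_subtype_val.comp continuous_snd).matrix_elem i j
      refine continuous_matrix fun i j => ?_
      fin_cases i <;> fin_cases j <;> simp [tens] <;> fun_prop
    exact (continuous_const.mul ht).mul continuous_const
  -- The image of the connected group SL₂(ℝ) × SL₂(ℝ) is connected and contains 1.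
  have := (isPreconnected_univ.image _ hcont.continuousOn).subset_connectedComponent
    (x := (1 : SOReal T)) ⟨1, trivial, by
      apply Subtype.ext
      apply Subtype.ext
      simp [tens_one, h₂]⟩
  refine ⟨_, this ⟨(A, B), trivial, rfl⟩, ?_⟩
  apply Subtype.ext
  change G⁻¹ * tens (A : Matrix (Fin 2) (Fin 2) ℝ) B * G = U
  rw [Matrix.mul_assoc, ← hU, ← Matrix.mul_assoc, h₂, Matrix.one_mul]

lemma SO0Real_le : SO0Real T ≤ SOReal T := by
  rintro _ ⟨U, -, rfl⟩
  exact U.2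

/-- The alternating block determinant is positive on the identity component. -/
lemma blockDet_pos (hG : IsUnit G.det) (hT : Gᵀ * splitForm ℝ * G = T.map (Int.cast : ℤ → ℝ))
    {U : Matrix.SpecialLinearGroup (Fin 4) ℝ} (hU : U ∈ SO0Real T) :
    0 < blockDet (G * U.1 * G⁻¹) := by
  obtain ⟨V, hV, rfl⟩ := hU
  let f : SOReal T → ℝ := fun V =>
    blockDet (G * V.1.1 * G⁻¹)
  have hf : Continuous f := by
    have h₀ : Continuous fun V : SOReal T => V.1.1 :=
      continuous_subtype_val.comp continuous_subtype_val
    have h : Continuous fun V : SOReal T => G * V.1.1 * G⁻¹ :=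
      (continuous_const.mul h₀).mul continuous_const
    have h' := fun i j => h.matrix_elem i j
    simp only [f, blockDet]
    fun_prop
  -- On the whole special orthogonal group the value is a sum of squares times det B, and neither
  -- factor vanishes because det A · det B = 1. The intermediate value theorem, starting from the
  -- value 2 at the identity, then fixes the sign.
  have hne : ∀ V, f V ≠ 0 := by
    intro V
    obtain ⟨A, B, hAB, e⟩ := exists_tens two_ne_zero _ ((mem_SOReal_iff hG hT _).mp V.2)
      (det_conj hG V)
    simp only [f]
    rw [e, blockDet_tens]
    refine mul_ne_zero ?_ (right_ne_zero_of_mul_eq_one hAB)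
    intro h0
    have hA : A.det = 0 := by
      have h1 : A 0 0 = 0 := by nlinarith [sq_nonneg (A 0 0), sq_nonneg (A 0 1), sq_nonneg (A 1 0), sq_nonneg (A 1 1)]
      have h2 : A 0 1 = 0 := by nlinarith [sq_nonneg (A 0 0), sq_nonneg (A 0 1), sq_nonneg (A 1 0), sq_nonneg (A 1 1)]
      rw [det_fin_two, h1, h2, zero_mul, zero_mul, sub_zero]
    simp [hA] at hAB
  have h1 : 0 < f 1 := by
    simp [f, mul_nonsing_inv G hG, blockDet]
  by_contra hneg
  have hp : IsPreconnected (connectedComponent (1 : SOReal T)) := isPreconnected_connectedComponent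
  obtain ⟨W, -, hW⟩ := hp.intermediate_value hV mem_connectedComponent hf.continuousOn
    ⟨not_lt.mp hneg, h1.le⟩
  exact hne W hW

/-! ### Quadratic fields -/

section Field

variable {K : Type*} [Field K]

/-- An integral matrix as a matrix over `K`. -/
def fieldMat (L : Matrix (Fin 2) (Fin 2) (𝓞 K)) : Matrix (Fin 2) (Fin 2) K :=
  L.map fun x => (x : K)

lemma realMat_eq_map (ι : K →+* ℝ) (L : Matrix (Fin 2) (Fin 2) (𝓞 K)) :
    realMat ι L = (fieldMat L).map ι := by
  ext i j
  simp [realMat, fieldMat]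

lemma fieldMat_mul (L N : Matrix (Fin 2) (Fin 2) (𝓞 K)) :
    fieldMat (L * N) = fieldMat L * fieldMat N :=
  Matrix.map_mul (f := algebraMap (𝓞 K) K)

lemma det_fieldMat (L : Matrix (Fin 2) (Fin 2) (𝓞 K)) : (fieldMat L).det = (L.det : K) :=
  ((algebraMap (𝓞 K) K).map_det L).symm

lemma det_realMat (ι : K →+* ℝ) (L : Matrix (Fin 2) (Fin 2) (𝓞 K)) :
    (realMat ι L).det = ι (L.det : K) :=
  ((ι.comp (algebraMap (𝓞 K) K)).map_det L).symm

/-- Forced by det M = 1. As ℓ is rational, the conjugate of L has determinant ℓ too, so M' also lies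
in SL₂(ℝ). -/
lemma det_of_isRep {ι : K →+* ℝ} {M : Matrix.SpecialLinearGroup (Fin 2) ℝ} {ℓ : ℕ}
    {L : Matrix (Fin 2) (Fin 2) (𝓞 K)} (h : IsRep ι M ℓ L) : L.det = (ℓ : 𝓞 K) := by
  have h0 : (0 : ℝ) < ℓ := Nat.cast_pos.mpr h.1
  have hd := M.det_coe
  rw [h.2, det_smul, det_realMat, Fintype.card_fin, div_pow, Real.sq_sqrt h0.le, one_pow] at hd
  have h1 : ι (L.det : K) = ι (ℓ : K) := by
    rw [map_natCast]
    field_simp at hd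
    exact hd
  have h2 := ι.injective h1
  exact RingOfIntegers.ext (by simpa using h2)

end Field

/-! ### Conjugation, the Gram matrix and base change in a quadratic field -/

section Quadratic

variable {K : Type*} [Field K] [NumberField K]

lemma isGalois_of_finrank_two (hK : Module.finrank ℚ K = 2) : IsGalois ℚ K := by
  have : Algebra.IsQuadraticExtension ℚ K := ⟨hK⟩
  infer_instance

variable {σ : K ≃ₐ[ℚ] K}

lemma univ_aut (hK : Module.finrank ℚ K = 2) (hσ : σ ≠ 1) [DecidableEq (K ≃ₐ[ℚ] K)] :
    (Finset.univ : Finset (K ≃ₐ[ℚ] K)) = {1, σ} := by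
  have := isGalois_of_finrank_two hK
  symm
  apply Finset.eq_univ_of_card
  rw [Finset.card_pair (Ne.symm hσ), ← hK, ← IsGalois.card_aut_eq_finrank, Nat.card_eq_fintype_card]

lemma conj_conj (hK : Module.finrank ℚ K = 2) (hσ : σ ≠ 1) (x : K) : σ (σ x) = x := by
  classical
  have h : σ * σ ∈ (Finset.univ : Finset (K ≃ₐ[ℚ] K)) := Finset.mem_univ _
  rw [univ_aut hK hσ] at h
  simp [hσ] at h
  exact DFunLike.congr_fun h x

lemma trace_eq (hK : Module.finrank ℚ K = 2) (hσ : σ ≠ 1) (x : K) :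
    ((Algebra.trace ℚ K x : ℚ) : K) = x + σ x := by
  classical
  have := isGalois_of_finrank_two hK
  have := trace_eq_sum_automorphisms (K := ℚ) x
  rw [univ_aut hK hσ, Finset.sum_pair (Ne.symm hσ)] at this
  simpa using this

lemma norm_eq (hK : Module.finrank ℚ K = 2) (hσ : σ ≠ 1) (x : K) :
    ((Algebra.norm ℚ x : ℚ) : K) = x * σ x := by
  classical
  have := isGalois_of_finrank_two hK
  have := Algebra.norm_eq_prod_automorphisms ℚ x
  rw [univ_aut hK hσ, Finset.prod_pair (Ne.symm hσ)] at this
  simpa using this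

lemma exists_rat_of_conj_eq (hK : Module.finrank ℚ K = 2) (hσ : σ ≠ 1) {x : K} (h : σ x = x) :
    ∃ q : ℚ, x = q := by
  refine ⟨Algebra.trace ℚ K x / 2, ?_⟩
  push_cast
  rw [trace_eq hK hσ, h]
  ring

variable (B : Module.Basis (Fin 2) ℤ (𝓞 K))

lemma ratBasis_apply (i : Fin 2) : ratBasis B i = (B i : K) := by
  simp [ratBasis, Module.Basis.localizationLocalization_apply]

lemma coords_sum (x : K) :
    (coords B x 0 : K) * (B 0 : K) + (coords B x 1 : K) * (B 1 : K) = x := by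
  have := (ratBasis B).sum_repr x
  rw [Fin.sum_univ_two, ratBasis_apply, ratBasis_apply, Algebra.smul_def, Algebra.smul_def] at this
  simpa [coords] using this

lemma coords_int (x : 𝓞 K) (i : Fin 2) : coords B (x : K) i = (B.repr x i : ℚ) := by
  simp only [coords, ratBasis]
  exact B.localizationLocalization_repr_algebraMap ℚ (nonZeroDivisors ℤ) K x i

lemma endoMat_col (p q : K) (j : Fin 2) :
    (endoMat σ B p q 0 j : K) * (B 0 : K) + (endoMat σ B p q 1 j : K) * (B 1 : K) =
      p * (B j : K) + q * σ (B j : K) := by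
  have h : ∀ i, endoMat σ B p q i j = coords B (p * (B j : K) + q * σ (B j : K)) i := by
    intro i
    simp [endoMat, LinearMap.toMatrix_apply, coords, ratBasis_apply]
  rw [h, h, coords_sum]

lemma gram_cast (hK : Module.finrank ℚ K = 2) (hσ : σ ≠ 1) (i j : Fin 2) :
    ((gram σ B i j : ℤ) : K) = (B i : K) * σ (B j : K) + σ (B i : K) * (B j : K) := by
  have h : ((gram σ B i j : ℤ) : ℚ) = Algebra.trace ℚ K ((B i : K) * σ (B j : K)) := by
    simp only [gram, of_apply]
    rw [Algebra.coe_trace_int]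
    rfl
  have h' := trace_eq hK hσ ((B i : K) * σ (B j : K))
  rw [← h, map_mul, conj_conj hK hσ] at h'
  simpa using h'

/-- Otherwise v/u would be fixed by conjugation, hence rational, against the independence of u and
v. This is what makes Ĝ invertible. -/
lemma conj_sub_ne_zero (hK : Module.finrank ℚ K = 2) (hσ : σ ≠ 1) :
    (B 0 : K) * σ (B 1 : K) - (B 1 : K) * σ (B 0 : K) ≠ 0 := by
  intro h
  have h0 : (B 0 : K) ≠ 0 := by
    rw [← ratBasis_apply]
    exact (ratBasis B).ne_zero 0
  have h0' : σ (B 0 : K) ≠ 0 := by simpa using h0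
  obtain ⟨q, hq⟩ := exists_rat_of_conj_eq hK hσ (x := (B 1 : K) / (B 0 : K)) (by
    rw [map_div₀]
    field_simp
    linear_combination h)
  have h1 : ratBasis B 1 = q • ratBasis B 0 := by
    rw [ratBasis_apply, ratBasis_apply, Algebra.smul_def]
    field_simp at hq
    rw [hq]
    simp [mul_comm]
  have := congrArg (fun z => (ratBasis B).repr z 1) h1
  simp at this

/-- The base change matrix over `K`. -/
noncomputable def fieldG (σ : K ≃ₐ[ℚ] K) (B : Module.Basis (Fin 2) ℤ (𝓞 K)) : Matrix (Fin 4) (Fin 4) K :=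
  !![1, 0, 0, 0;
     0, (B 0 : K), (B 1 : K), 0;
     0, σ (B 0 : K), σ (B 1 : K), 0;
     0, 0, 0, 1]

lemma hatG_eq_map (ι : K →+* ℝ) : hatG ι σ B = (fieldG σ B).map ι := by
  ext i j
  fin_cases i <;> fin_cases j <;> simp [hatG, fieldG]

lemma det_fieldG (hK : Module.finrank ℚ K = 2) (hσ : σ ≠ 1) : (fieldG σ B).det ≠ 0 := by
  rw [det_fin_four]
  simpa [fieldG] using conj_sub_ne_zero B hK hσ

lemma fieldG_form (hK : Module.finrank ℚ K = 2) (hσ : σ ≠ 1) :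
    (fieldG σ B)ᵀ * splitForm K * fieldG σ B = (hyp (gram σ B)).map (Int.cast : ℤ → K) := by
  ext i j
  fin_cases i <;> fin_cases j <;>
    simp [fieldG, splitForm, hyp, Matrix.mul_apply, Fin.sum_univ_succ, gram_cast B hK hσ] <;> ring

/-- The identity `Ĝ M̃ = Ω(M, M') Ĝ`. -/
lemma fieldG_mul_tildeMat (hK : Module.finrank ℚ K = 2) (hσ : σ ≠ 1) (ℓ : ℕ)
    (L : Matrix (Fin 2) (Fin 2) (𝓞 K)) :
    fieldG σ B * (tildeMat σ B ℓ L).map (Rat.cast : ℚ → K) =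
      (ℓ : K)⁻¹ • tens (fieldMat L) ((fieldMat L).map σ) * fieldG σ B := by
  have cs := coords_sum B
  have cs' : ∀ x : K, (coords B x 0 : K) * σ (B 0 : K) + (coords B x 1 : K) * σ (B 1 : K) = σ x := by
    intro x
    conv_rhs => rw [← cs x]
    simp
  have es := endoMat_col (σ := σ) B
  have es' : ∀ (p q : K) (j : Fin 2), (endoMat σ B p q 0 j : K) * σ (B 0 : K) +
      (endoMat σ B p q 1 j : K) * σ (B 1 : K) = σ p * σ (B j : K) + σ q * (B j : K) := by
    intro p q j
    have := congrArg σ (es p q j)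
    simpa [conj_conj hK hσ] using this
  -- Multiplying the coordinates of x by S gives the values of w ↦ Tr(x w') on the basis; this
  -- accounts for the entries of M̃ of the form aᵗʳS and dᵗʳS.
  have gs : ∀ (x : K) (j : Fin 2), (coords B x 0 : K) * (gram σ B 0 j : K) +
      (coords B x 1 : K) * (gram σ B 1 j : K) = x * σ (B j : K) + σ x * (B j : K) := by
    intro x j
    rw [gram_cast B hK hσ, gram_cast B hK hσ]
    linear_combination σ (B j : K) * cs x + (B j : K) * cs' x
  have cn : ∀ x y : K, σ (-(x * σ y / ℓ)) = -(σ x * y / ℓ) := fun x y => by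
    simp [conj_conj hK hσ]
  have cp : ∀ x y : K, σ (x * σ y / ℓ) = σ x * y / ℓ := fun x y => by
    simp [conj_conj hK hσ]
  ext i j
  fin_cases i <;> fin_cases j <;>
    simp [fieldG, tildeMat, fieldMat, tens, Matrix.mul_apply, Fin.sum_univ_succ, Matrix.vecMul,
      dotProduct, norm_eq hK hσ, gs, cn, cp, -map_neg, -map_mul, -map_div₀]
  · ring
  · ring
  · ring
  · ring
  · linear_combination cs (-(↑(L 0 0) * σ ↑(L 1 0) / ↑ℓ))
  · linear_combination es (↑(L 0 0) * σ ↑(L 1 1) / ↑ℓ) (↑(L 0 1) * σ ↑(L 1 0) / ↑ℓ) 0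
  · linear_combination es (↑(L 0 0) * σ ↑(L 1 1) / ↑ℓ) (↑(L 0 1) * σ ↑(L 1 0) / ↑ℓ) 1
  · linear_combination cs (↑(L 0 1) * σ ↑(L 1 1) / ↑ℓ)
  · linear_combination cs' (-(↑(L 0 0) * σ ↑(L 1 0) / ↑ℓ)) + cn (L 0 0) (L 1 0)
  · linear_combination es' (↑(L 0 0) * σ ↑(L 1 1) / ↑ℓ) (↑(L 0 1) * σ ↑(L 1 0) / ↑ℓ) 0 +
      σ (B 0 : K) * cp (L 0 0) (L 1 1) + (B 0 : K) * cp (L 0 1) (L 1 0)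
  · linear_combination es' (↑(L 0 0) * σ ↑(L 1 1) / ↑ℓ) (↑(L 0 1) * σ ↑(L 1 0) / ↑ℓ) 1 +
      σ (B 1 : K) * cp (L 0 0) (L 1 1) + (B 1 : K) * cp (L 0 1) (L 1 0)
  · linear_combination cs' (↑(L 0 1) * σ ↑(L 1 1) / ↑ℓ) + cp (L 0 1) (L 1 1)
  · ring
  · ring
  · ring
  · ring

end Quadratic

/-! ### The rational orthogonal group -/

section Rational

variable {K : Type*} [Field K] [NumberField K] {σ : K ≃ₐ[ℚ] K}
  (B : Module.Basis (Fin 2) ℤ (𝓞 K))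

lemma isUnit_det_hatG (hK : Module.finrank ℚ K = 2) (hσ : σ ≠ 1) (ι : K →+* ℝ) :
    IsUnit (hatG ι σ B).det := by
  have h : (hatG ι σ B).det = ι (fieldG σ B).det := by
    rw [hatG_eq_map]
    exact (ι.map_det _).symm
  rw [h, isUnit_iff_ne_zero]
  exact (map_ne_zero ι).mpr (det_fieldG B hK hσ)

lemma hatG_form (hK : Module.finrank ℚ K = 2) (hσ : σ ≠ 1) (ι : K →+* ℝ) :
    (hatG ι σ B)ᵀ * splitForm ℝ * hatG ι σ B = (hyp (gram σ B)).map (Int.cast : ℤ → ℝ) := by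
  have h := congrArg (fun Z => Z.map ι) (fieldG_form B hK hσ)
  have e : (splitForm K).map ι = splitForm ℝ := by
    ext i j
    fin_cases i <;> fin_cases j <;> simp [splitForm]
  simp only [Matrix.map_mul, e, transpose_map] at h
  rw [hatG_eq_map, h]
  ext i j
  simp

lemma hatG_mul_tildeMat (hK : Module.finrank ℚ K = 2) (hσ : σ ≠ 1) (ι : K →+* ℝ) (ℓ : ℕ)
    (L : Matrix (Fin 2) (Fin 2) (𝓞 K)) :
    hatG ι σ B * (tildeMat σ B ℓ L).map (Rat.cast : ℚ → ℝ) =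
      tens ((1 / √(ℓ : ℝ)) • realMat ι L)
        ((1 / √(ℓ : ℝ)) • realMat (ι.comp (σ : K →+* K)) L) * hatG ι σ B := by
  have h := congrArg (fun Z => Z.map ι) (fieldG_mul_tildeMat B hK hσ ℓ L)
  have e : ((tildeMat σ B ℓ L).map (Rat.cast : ℚ → K)).map ι =
      (tildeMat σ B ℓ L).map (Rat.cast : ℚ → ℝ) := by
    ext i j
    simp
  have e' : (((ℓ : K)⁻¹ • tens (fieldMat L) ((fieldMat L).map σ))).map ι =
      (ℓ : ℝ)⁻¹ • tens (realMat ι L) (realMat (ι.comp (σ : K →+* K)) L) := by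
    rw [realMat_eq_map, realMat_eq_map]
    ext i j
    fin_cases i <;> fin_cases j <;> simp [tens]
  simp only [Matrix.map_mul, e, e'] at h
  rw [hatG_eq_map, h, tens_smul]
  congr 2
  rw [div_mul_div_comm, Real.mul_self_sqrt (Nat.cast_nonneg _)]
  simp

/-- Ĝ is invertible and ℚ → K is injective, so identities about M̃ can be tested after base change,
where they concern twisted products only. -/
lemma tildeMat_eq_iff (hK : Module.finrank ℚ K = 2) (hσ : σ ≠ 1) (ℓ : ℕ)
    (L : Matrix (Fin 2) (Fin 2) (𝓞 K)) (U : Matrix (Fin 4) (Fin 4) ℚ) :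
    tildeMat σ B ℓ L = U ↔ fieldG σ B * U.map (Rat.cast : ℚ → K) =
      (ℓ : K)⁻¹ • tens (fieldMat L) ((fieldMat L).map σ) * fieldG σ B := by
  rw [← fieldG_mul_tildeMat B hK hσ]
  constructor
  · intro h
    rw [h]
  · intro h
    have hu : IsUnit (fieldG σ B) :=
      (Matrix.isUnit_iff_isUnit_det _).mpr (isUnit_iff_ne_zero.mpr (det_fieldG B hK hσ))
    exact (Matrix.map_injective Rat.cast_injective (hu.mul_left_cancel h)).symm

lemma tildeMat_mul (hK : Module.finrank ℚ K = 2) (hσ : σ ≠ 1) (k ℓ : ℕ)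
    (L N : Matrix (Fin 2) (Fin 2) (𝓞 K)) :
    tildeMat σ B (k * ℓ) (L * N) = tildeMat σ B k L * tildeMat σ B ℓ N := by
  rw [tildeMat_eq_iff B hK hσ]
  have e : (tildeMat σ B k L * tildeMat σ B ℓ N).map (Rat.cast : ℚ → K) =
      (tildeMat σ B k L).map (Rat.cast : ℚ → K) * (tildeMat σ B ℓ N).map (Rat.cast : ℚ → K) :=
    Matrix.map_mul (f := Rat.castHom K)
  have e' : (fieldMat L * fieldMat N).map σ = (fieldMat L).map σ * (fieldMat N).map σ :=
    Matrix.map_mul (f := σ.toRingEquiv.toRingHom)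
  rw [e, ← Matrix.mul_assoc, fieldG_mul_tildeMat B hK hσ, Matrix.mul_assoc,
    fieldG_mul_tildeMat B hK hσ, ← Matrix.mul_assoc, smul_mul_smul_comm, tens_mul, fieldMat_mul, e']
  congr 2
  push_cast
  rw [mul_inv]

lemma det_tildeMat (hK : Module.finrank ℚ K = 2) (hσ : σ ≠ 1) {ι : K →+* ℝ}
    {M : Matrix.SpecialLinearGroup (Fin 2) ℝ} {ℓ : ℕ} {L : Matrix (Fin 2) (Fin 2) (𝓞 K)}
    (h : IsRep ι M ℓ L) : (tildeMat σ B ℓ L).det = 1 := by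
  have h0 : (ℓ : K) ≠ 0 := Nat.cast_ne_zero.mpr h.1.ne'
  have h1 := congrArg Matrix.det (fieldG_mul_tildeMat B hK hσ ℓ L)
  have e : ((fieldMat L).map σ).det = σ (fieldMat L).det :=
    (σ.toRingEquiv.toRingHom.map_det (fieldMat L)).symm
  have e' : ((tildeMat σ B ℓ L).map (Rat.cast : ℚ → K)).det = ((tildeMat σ B ℓ L).det : ℚ) :=
    ((Rat.castHom K).map_det _).symm
  rw [det_mul, det_mul, det_smul, det_tens, e, e', det_fieldMat, det_of_isRep h] at h1
  simp at h1
  have h2 : ((tildeMat σ B ℓ L).det : K) = ((1 : ℚ) : K) := by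
    rw [mul_comm] at h1
    rw [mul_right_cancel₀ (det_fieldG B hK hσ) h1]
    field_simp
    simp
  exact Rat.cast_injective h2

lemma exists_mem_SO0Rat (hK : Module.finrank ℚ K = 2) (hσ : σ ≠ 1) {ι : K →+* ℝ}
    {M : Matrix.SpecialLinearGroup (Fin 2) ℝ} {ℓ : ℕ} {L : Matrix (Fin 2) (Fin 2) (𝓞 K)}
    (h : IsRep ι M ℓ L) : ∃ U : SO0Rat (hyp (gram σ B)), U.1.1 = tildeMat σ B ℓ L := by
  have h0 : (0 : ℝ) < ℓ := Nat.cast_pos.mpr h.1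
  refine ⟨⟨⟨_, det_tildeMat B hK hσ h⟩, ?_⟩, rfl⟩
  have hd : ((1 / √(ℓ : ℝ)) • realMat (ι.comp (σ : K →+* K)) L).det = 1 := by
    rw [det_smul, det_realMat, det_of_isRep h, Fintype.card_fin, div_pow, Real.sq_sqrt h0.le]
    simp [h0.ne']
  refine mem_SO0Real_of_tens (isUnit_det_hatG B hK hσ ι) (hatG_form B hK hσ ι) M ⟨_, hd⟩ _ ?_
  rw [h.2]
  exact hatG_mul_tildeMat B hK hσ ι ℓ L

lemma mem_pmOne_iff_scalar {ι : K →+* ℝ} {M : Matrix.SpecialLinearGroup (Fin 2) ℝ} {ℓ : ℕ}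
    {L : Matrix (Fin 2) (Fin 2) (𝓞 K)} (h : IsRep ι M ℓ L) :
    M ∈ pmOne 2 ℝ ↔ L 0 1 = 0 ∧ L 1 0 = 0 ∧ L 0 0 = L 1 1 := by
  have h0 : (0 : ℝ) < ℓ := Nat.cast_pos.mpr h.1
  have hs : (√(ℓ : ℝ))⁻¹ ≠ 0 := by positivity
  have hM : ∀ i j, M.1 i j = (√(ℓ : ℝ))⁻¹ * ι (L i j : K) := by
    intro i j
    rw [h.2]
    simp [realMat]
  have hz : ∀ i j, M.1 i j = 0 ↔ L i j = 0 := by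
    intro i j
    rw [hM, mul_eq_zero, or_iff_right hs, map_eq_zero, RingOfIntegers.coe_eq_zero_iff]
  have he : M.1 0 0 = M.1 1 1 ↔ L 0 0 = L 1 1 := by
    rw [hM, hM, mul_right_inj' hs, ι.injective.eq_iff, RingOfIntegers.ext_iff]
  rw [← hz, ← hz, ← he]
  change M.1 = 1 ∨ M.1 = -1 ↔ _
  constructor
  · rintro (e | e) <;> simp [e]
  · rintro ⟨h1, h2, h3⟩
    have hd := M.2
    rw [det_fin_two, h1, h2, ← h3] at hd
    have : (M.1 0 0 - 1) * (M.1 0 0 + 1) = 0 := by linear_combination hd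
    rcases mul_eq_zero.mp this with e | e
    · left
      have e' : M.1 0 0 = 1 := by linear_combination e
      ext i j
      fin_cases i <;> fin_cases j <;> simp [h1, h2, ← h3, e']
    · right
      have e' : M.1 0 0 = -1 := by linear_combination e
      ext i j
      fin_cases i <;> fin_cases j <;> simp [h1, h2, ← h3, e']

lemma tildeMat_eq_smul_one_iff (hK : Module.finrank ℚ K = 2) (hσ : σ ≠ 1) {ℓ : ℕ} (hℓ : 0 < ℓ)
    (L : Matrix (Fin 2) (Fin 2) (𝓞 K)) {ε : ℚ} (hε : ε ≠ 0) :
    tildeMat σ B ℓ L = ε • 1 ↔ L 0 1 = 0 ∧ L 1 0 = 0 ∧ L 0 0 = L 1 1 ∧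
      (L 0 0 : K) * σ (L 0 0 : K) = ε * ℓ := by
  have h0 : (ℓ : K) ≠ 0 := Nat.cast_ne_zero.mpr hℓ.ne'
  have hε' : (ε : K) ≠ 0 := Rat.cast_ne_zero.mpr hε
  have e : ((ε • 1 : Matrix (Fin 4) (Fin 4) ℚ)).map (Rat.cast : ℚ → K) = (ε : K) • 1 := by
    ext i j
    by_cases hij : i = j <;> simp [hij]
  have hu : IsUnit (fieldG σ B) :=
    (Matrix.isUnit_iff_isUnit_det _).mpr (isUnit_iff_ne_zero.mpr (det_fieldG B hK hσ))
  rw [tildeMat_eq_iff B hK hσ, e, Matrix.mul_smul, Matrix.mul_one]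
  have e2 : (ε : K) • fieldG σ B = ((ε : K) • 1 : Matrix (Fin 4) (Fin 4) K) * fieldG σ B := by
    rw [Matrix.smul_mul, Matrix.one_mul]
  rw [e2, hu.mul_left_inj]
  constructor
  · intro h
    have h' : ∀ i j, tens (fieldMat L) ((fieldMat L).map σ) i j =
        (ε : K) * ℓ * (1 : Matrix (Fin 4) (Fin 4) K) i j := by
      intro i j
      have := congrFun (congrFun h i) j
      simp only [Matrix.smul_apply, smul_eq_mul] at this
      field_simp at this
      linear_combination -this
    have t00 := h' 0 0
    have t01 := h' 0 1
    have t02 := h' 0 2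
    have t11 := h' 1 1
    have t13 := h' 1 3
    have t20 := h' 2 0
    have t22 := h' 2 2
    simp [tens, fieldMat] at t00 t01 t02 t11 t13 t20 t22
    have hne : (L 0 0 : K) ≠ 0 := by
      intro h
      rw [h, zero_mul] at t00
      exact mul_ne_zero hε' h0 t00.symm
    have hne' : L 0 0 ≠ 0 := by
      intro h
      simp [h] at hne
    refine ⟨t01.resolve_left hne', ?_, ?_, t00⟩
    · exact t20.resolve_right hne'
    · have : (L 0 0 : K) * σ (L 0 0 : K) = (L 1 1 : K) * σ (L 0 0 : K) := by rw [t00, t22]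
      have := mul_right_cancel₀ ((map_ne_zero σ).mpr hne) this
      exact RingOfIntegers.ext this
  · rintro ⟨h1, h2, h3, h4⟩
    ext i j
    fin_cases i <;> fin_cases j <;> simp [tens, fieldMat, h1, h2, ← h3, h4] <;> field_simp

/-- If L is the scalar x, then x² = ℓ forces x' = x or x' = -x, and M̃ = x x'/ℓ · I is I or -I
accordingly. The case x' = -x shows why signs must be divided out on the orthogonal side. -/
lemma mem_pmOne_iff_tildeMat (hK : Module.finrank ℚ K = 2) (hσ : σ ≠ 1) {ι : K →+* ℝ}
    {M : Matrix.SpecialLinearGroup (Fin 2) ℝ} {ℓ : ℕ} {L : Matrix (Fin 2) (Fin 2) (𝓞 K)}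
    (h : IsRep ι M ℓ L) :
    M ∈ pmOne 2 ℝ ↔ tildeMat σ B ℓ L = 1 ∨ tildeMat σ B ℓ L = -1 := by
  have e1 := tildeMat_eq_smul_one_iff B hK hσ h.1 L (ε := 1) one_ne_zero
  have e2 := tildeMat_eq_smul_one_iff B hK hσ h.1 L (ε := -1) (by norm_num)
  rw [one_smul] at e1
  rw [neg_smul, one_smul] at e2
  rw [mem_pmOne_iff_scalar h, e1, e2]
  constructor
  · rintro ⟨h1, h2, h3⟩
    have hd := det_of_isRep h
    rw [det_fin_two, h1, h2, ← h3] at hd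
    have hd' : (L 0 0 : K) * (L 0 0 : K) = ℓ := by
      have := congrArg (fun x : 𝓞 K => (x : K)) hd
      simpa using this
    have hd'' := congrArg σ hd'
    rw [map_mul, map_natCast, ← hd'] at hd''
    rcases mul_self_eq_mul_self_iff.mp hd'' with h' | h'
    · left
      exact ⟨h1, h2, h3, by rw [h', hd']; simp⟩
    · right
      exact ⟨h1, h2, h3, by rw [h', mul_neg, hd']; simp⟩
  · rintro (⟨h1, h2, h3, -⟩ | ⟨h1, h2, h3, -⟩) <;> exact ⟨h1, h2, h3⟩

end Rational

/-! ### Galois descent, Hilbert 90 and surjectivity over ℚ -/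

section Rational

variable {K : Type*} [Field K] [NumberField K] {σ : K ≃ₐ[ℚ] K}
  (B : Module.Basis (Fin 2) ℤ (𝓞 K))

lemma exists_int_of_conj_eq (hK : Module.finrank ℚ K = 2) (hσ : σ ≠ 1) {x : 𝓞 K}
    (h : σ (x : K) = x) : ∃ n : ℤ, x = n := by
  obtain ⟨q, hq⟩ := exists_rat_of_conj_eq hK hσ h
  have hi : IsIntegral ℤ q := by
    rw [← isIntegral_algebraMap_iff (algebraMap ℚ K).injective]
    have : algebraMap ℚ K q = x := by simp [hq]
    rw [this]
    exact RingOfIntegers.isIntegral_coe x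
  obtain ⟨n, hn⟩ := IsIntegrallyClosed.isIntegral_iff.mp hi
  refine ⟨n, RingOfIntegers.ext ?_⟩
  rw [hq, ← hn]
  simp

/-- The permutation matrix interchanging the two middle coordinates. -/
def midSwap (R : Type*) [CommRing R] : Matrix (Fin 4) (Fin 4) R :=
  !![1, 0, 0, 0; 0, 0, 1, 0; 0, 1, 0, 0; 0, 0, 0, 1]

lemma midSwap_mul_tens {R : Type*} [CommRing R] (A C : Matrix (Fin 2) (Fin 2) R) :
    midSwap R * tens A C = tens C A * midSwap R := by
  ext i j
  fin_cases i <;> fin_cases j <;>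
    simp [midSwap, tens, Matrix.mul_apply, Fin.sum_univ_succ, mul_comm]

/-- The descent datum: conjugation exchanges the two middle rows, and conjugating by this swap
exchanges the factors of a twisted product. -/
lemma fieldG_map_conj (hK : Module.finrank ℚ K = 2) (hσ : σ ≠ 1) :
    (fieldG σ B).map σ = midSwap K * fieldG σ B := by
  ext i j
  fin_cases i <;> fin_cases j <;>
    simp [midSwap, fieldG, Matrix.mul_apply, Fin.sum_univ_succ, conj_conj hK hσ]

/-- Galois descent for twisted tensor products which are rational in the basis `B`. -/
lemma exists_conj_factor (hK : Module.finrank ℚ K = 2) (hσ : σ ≠ 1)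
    (U : Matrix (Fin 4) (Fin 4) ℚ) {A C : Matrix (Fin 2) (Fin 2) K} (hAC : A.det * C.det = 1)
    (h : fieldG σ B * U.map (Rat.cast : ℚ → K) = tens A C * fieldG σ B) :
    ∃ c : K, σ c = c ∧ C = c • A.map σ := by
  have hu : IsUnit (fieldG σ B) :=
    (Matrix.isUnit_iff_isUnit_det _).mpr (isUnit_iff_ne_zero.mpr (det_fieldG B hK hσ))
  have hA : A ≠ 0 := by
    rintro rfl
    simp at hAC
  have hA' : A.map σ ≠ 0 := by
    intro h0
    apply hA
    ext i j
    simpa using congrFun (congrFun h0 i) j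
  have h1 := congrArg (fun Z => Z.map (σ : K →+* K)) h
  have e : (U.map (Rat.cast : ℚ → K)).map (σ : K →+* K) = U.map (Rat.cast : ℚ → K) := by
    ext i j
    simp
  simp only [Matrix.map_mul, e, tens_map] at h1
  change (fieldG σ B).map σ * _ = tens (A.map σ) (C.map σ) * (fieldG σ B).map σ at h1
  have hs : midSwap K * midSwap K = 1 := by
    ext i j
    fin_cases i <;> fin_cases j <;> simp [midSwap, Matrix.mul_apply, Fin.sum_univ_succ]
  rw [fieldG_map_conj B hK hσ, Matrix.mul_assoc, h, ← Matrix.mul_assoc, ← Matrix.mul_assoc,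
    hu.mul_left_inj, midSwap_mul_tens] at h1
  -- The conjugate of the equation for the rational matrix U, with the middle swap cancelled.
  have h2 : tens C A = tens (A.map σ) (C.map σ) := by
    have := congrArg (fun Z => Z * midSwap K) h1
    simpa only [Matrix.mul_assoc, hs, Matrix.mul_one] using this
  obtain ⟨d, hd⟩ := exists_smul_of_tens_eq h2.symm hA'
  have hC : C = σ d • A.map σ := by
    ext i j
    have := congrArg σ (congrFun (congrFun hd i) j)
    simpa [conj_conj hK hσ] using this
  refine ⟨σ d, ?_, hC⟩
  rw [conj_conj hK hσ]
  -- Substituting C = σ(d) A' on one side of the conjugated equation and C' = d A on the other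
  -- compares σ(d) with d, so the scalar is rational.
  have h3 : (σ d) • tens (A.map σ) A = d • tens (A.map σ) A := by
    have e1 : tens C A = (σ d) • tens (A.map σ) A := by
      rw [hC]
      simpa using tens_smul (σ d) 1 (A.map σ) A
    have e2 : tens (A.map σ) (C.map σ) = d • tens (A.map σ) A := by
      rw [hd]
      simpa using tens_smul 1 d (A.map σ) A
    rw [← e1, ← e2, h2]
  have hdet : (tens (A.map σ) A).det ≠ 0 := by
    have e3 : (A.map σ).det = σ A.det := (σ.toRingEquiv.toRingHom.map_det A).symm
    have : A.det ≠ 0 := left_ne_zero_of_mul_eq_one hAC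
    rw [det_tens, e3]
    exact pow_ne_zero _ (mul_ne_zero ((map_ne_zero σ).mpr this) this)
  have hne : tens (A.map σ) A ≠ 0 := by
    intro h0
    rw [h0] at hdet
    simp at hdet
  have h4 : (d - σ d) • tens (A.map σ) A = 0 := by rw [sub_smul, h3, sub_self]
  exact sub_eq_zero.mp ((smul_eq_zero.mp h4).resolve_right hne)

/-- An explicit form of Hilbert's Theorem 90. -/
lemma exists_conj_eq_mul (hK : Module.finrank ℚ K = 2) (hσ : σ ≠ 1) {z : K} (hz : z * σ z = 1) :
    ∃ μ : K, μ ≠ 0 ∧ σ μ = z * μ := by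
  -- The usual witness 1 + σ z works because z · σ z = 1, but it vanishes for z = -1; there an
  -- anti-invariant element w - σ w serves.
  by_cases h : z = -1
  · obtain ⟨w, hw⟩ : ∃ w, σ w ≠ w := by
      by_contra! h'
      exact hσ (AlgEquiv.ext h')
    refine ⟨w - σ w, sub_ne_zero.mpr hw.symm, ?_⟩
    rw [map_sub, conj_conj hK hσ, h]
    ring
  · refine ⟨1 + σ z, ?_, ?_⟩
    · intro h'
      apply h
      have := congrArg σ h'
      rw [map_add, map_one, map_zero, conj_conj hK hσ] at this
      linear_combination this
    · rw [map_add, map_one, conj_conj hK hσ]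
      linear_combination -hz

lemma exists_integral_multiple (A : Matrix (Fin 2) (Fin 2) K) :
    ∃ (b : 𝓞 K) (L : Matrix (Fin 2) (Fin 2) (𝓞 K)), b ≠ 0 ∧ fieldMat L = (b : K) • A := by
  obtain ⟨b, hb⟩ := IsLocalization.exist_integer_multiples_of_finite (nonZeroDivisors (𝓞 K))
    (fun p : Fin 2 × Fin 2 => A p.1 p.2)
  choose f hf using hb
  refine ⟨b, Matrix.of fun i j => f (i, j), nonZeroDivisors.ne_zero b.2, ?_⟩
  ext i j
  have := hf (i, j)
  rw [Algebra.smul_def] at this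
  simpa [fieldMat] using this

/-- Every element of the rational orthogonal group comes from the group `Σ_K`. -/
theorem exists_isRep_of_mem_SO0Rat (hK : Module.finrank ℚ K = 2) (hσ : σ ≠ 1) (ι : K →+* ℝ)
    {U : Matrix.SpecialLinearGroup (Fin 4) ℚ} (hU : U ∈ SO0Rat (hyp (gram σ B))) :
    ∃ (M : Matrix.SpecialLinearGroup (Fin 2) ℝ) (ℓ : ℕ) (L : Matrix (Fin 2) (Fin 2) (𝓞 K)),
      IsRep ι M ℓ L ∧ tildeMat σ B ℓ L = U.1 := by
  set V : Matrix.SpecialLinearGroup (Fin 4) ℝ :=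
    Matrix.SpecialLinearGroup.map (algebraMap ℚ ℝ) U with hVdef
  have hV : V ∈ SO0Real (hyp (gram σ B)) := hU
  have hG := isUnit_det_hatG B hK hσ ι
  have hF := hatG_form B hK hσ ι
  have hdet : IsUnit (fieldG σ B).det := isUnit_iff_ne_zero.mpr (det_fieldG B hK hσ)
  -- Conjugating over K rather than ℝ yields factors with entries in K, to which σ can be applied.
  set T := fieldG σ B * U.1.map (Rat.cast : ℚ → K) * (fieldG σ B)⁻¹ with hT
  have hTG : fieldG σ B * U.1.map (Rat.cast : ℚ → K) = T * fieldG σ B := by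
    rw [hT, Matrix.mul_assoc, nonsing_inv_mul _ hdet, Matrix.mul_one]
  have hTR : T.map ι = hatG ι σ B * V.1 * (hatG ι σ B)⁻¹ := by
    have h1 := congrArg (fun Z => Z.map ι) hTG
    have e : (U.1.map (Rat.cast : ℚ → K)).map ι = V.1 := by
      ext i j
      simp [hVdef]
    simp only [Matrix.map_mul, e, ← hatG_eq_map] at h1
    rw [h1, Matrix.mul_assoc, mul_nonsing_inv _ hG, Matrix.mul_one]
  have hTf : Tᵀ * splitForm K * T = splitForm K := by
    have h1 := (mem_SOReal_iff hG hF V).mp (SO0Real_le hV)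
    rw [← hTR] at h1
    have e : splitForm ℝ = (splitForm K).map ι := by
      ext i j
      fin_cases i <;> fin_cases j <;> simp [splitForm]
    rw [e, ← transpose_map, ← Matrix.map_mul, ← Matrix.map_mul] at h1
    exact Matrix.map_injective ι.injective h1
  have hTd : T.det = 1 := by
    have e : (U.1.map (Rat.cast : ℚ → K)).det = ((U.1.det : ℚ) : K) :=
      ((Rat.castHom K).map_det _).symm
    rw [hT, det_mul, det_mul, e, U.2, Rat.cast_one, mul_one, ← det_mul, mul_nonsing_inv _ hdet,
      det_one]
  obtain ⟨A, C, hAC, hTAC⟩ := exists_tens two_ne_zero T hTf hTd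
  rw [hTAC] at hTG
  obtain ⟨c, hc, rfl⟩ := exists_conj_factor B hK hσ U.1 hAC hTG
  have hcT : tens A (c • A.map σ) = c • tens A (A.map σ) := by
    simpa using tens_smul 1 c A (A.map σ)
  have hAσ : (A.map σ).det = σ A.det := (σ.toRingEquiv.toRingHom.map_det A).symm
  rw [det_smul, hAσ, Fintype.card_fin] at hAC
  -- Membership in the identity component makes the second determinant positive, and the two
  -- determinants multiply to 1.
  have hdpos : 0 < ι A.det := by
    have h1 := blockDet_pos hG hF hV
    have e : (tens A (c • A.map σ)).map ι = tens (A.map ι) ((c • A.map σ).map ι) := tens_map ι _ _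
    have e1 : (A.map ι).det = ι A.det := (ι.map_det A).symm
    have e2 : ((c • A.map σ).map ι).det = ι (c • A.map σ).det := (ι.map_det _).symm
    rw [← hTR, hTAC, e, blockDet_tens, e2, det_smul, hAσ, Fintype.card_fin] at h1
    have h2 := pos_of_mul_pos_right h1 (by positivity)
    have h3 : ι A.det * ι (c ^ 2 * σ A.det) = 1 := by rw [← map_mul, hAC, map_one]
    exact pos_of_mul_pos_left (by rw [h3]; exact one_pos) h2.le
  -- The determinant condition reads c² det A (det A)' = 1 with c' = c, so c det A has norm one.
  obtain ⟨μ, hμ, hμz⟩ := exists_conj_eq_mul hK hσ (z := c * A.det) (by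
    rw [map_mul, hc]
    linear_combination hAC)
  obtain ⟨b, L₀, hb, hL₀⟩ := exists_integral_multiple (μ • A)
  set b' : 𝓞 K := RingOfIntegers.mapRingEquiv (σ : K ≃+* K) b with hb'
  have hb'σ : (b' : K) = σ (b : K) := rfl
  have hbne : (b : K) ≠ 0 := RingOfIntegers.coe_ne_zero_iff.mpr hb
  have hb'ne : (b' : K) ≠ 0 := by
    rw [hb'σ]
    exact (map_ne_zero σ).mpr hbne
  -- The factor b clears the denominators of μ A; the extra b' makes the multiplier b b' a norm, so
  -- κ'/κ = μ'/μ = c det A is unchanged.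
  set κ : K := b' * (b * μ) with hκ
  have hκ0 : κ ≠ 0 := mul_ne_zero hb'ne (mul_ne_zero hbne hμ)
  have hκσ : σ κ = c * A.det * κ := by
    rw [hκ, map_mul, map_mul, hμz, hb'σ, conj_conj hK hσ]
    ring
  set L : Matrix (Fin 2) (Fin 2) (𝓞 K) := b' • L₀ with hL
  have hLA : fieldMat L = κ • A := by
    have : fieldMat L = (b' : K) • fieldMat L₀ := by
      ext i j
      simp [hL, fieldMat]
    rw [this, hL₀, smul_smul, smul_smul, hκ, mul_assoc]
  have hLd : (L.det : K) = κ ^ 2 * A.det := by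
    rw [← det_fieldMat, hLA, det_smul, Fintype.card_fin]
  have hc0 : c ≠ 0 := by
    rintro rfl
    simp at hAC
  -- Conjugation multiplies κ² det A by c² det A (det A)' = 1, so this determinant is a rational
  -- integer. It becomes ℓ, and then κ κ'/ℓ = c recovers the scalar.
  obtain ⟨n, hn⟩ := exists_int_of_conj_eq hK hσ (x := L.det) (by
    rw [hLd, map_mul, map_pow, hκσ]
    linear_combination κ ^ 2 * A.det * hAC)
  have hnK : (n : K) = κ ^ 2 * A.det := by
    rw [← hLd, hn]
    simp
  have hnpos : 0 < n := by
    have h1 : (n : ℝ) = ι κ ^ 2 * ι A.det := by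
      rw [← map_pow, ← map_mul, ← hnK, map_intCast]
    have h2 : ι κ ≠ 0 := (map_ne_zero ι).mpr hκ0
    have h3 : (0 : ℝ) < n := by
      rw [h1]
      positivity
    exact_mod_cast h3
  lift n to ℕ using hnpos.le with ℓ hℓ
  have hℓ0 : 0 < ℓ := by exact_mod_cast hnpos
  have hℓR : (0 : ℝ) < ℓ := by exact_mod_cast hℓ0
  have hMd : ((1 / √(ℓ : ℝ)) • realMat ι L).det = 1 := by
    rw [det_smul, det_realMat, hn, Fintype.card_fin, div_pow, Real.sq_sqrt hℓR.le]
    simp [hℓR.ne']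
  refine ⟨⟨_, hMd⟩, ℓ, L, ⟨hℓ0, rfl⟩, ?_⟩
  rw [tildeMat_eq_iff B hK hσ, hTG, hcT, hLA]
  have e : (κ • A).map σ = σ κ • A.map σ := by
    ext i j
    simp
  rw [e, tens_smul, smul_smul]
  congr 2
  have hℓK : (ℓ : K) = κ ^ 2 * A.det := by exact_mod_cast hnK
  have hd0 : A.det ≠ 0 := left_ne_zero_of_mul_eq_one hAC
  rw [hℓK, hκσ]
  field_simp

/-- The isomorphism of `Σ_K / {± I}` with the rational orthogonal group modulo signs. -/
theorem exists_mulEquiv_SO0Rat (hK : Module.finrank ℚ K = 2) (hσ : σ ≠ 1) (ι : K →+* ℝ) :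
    ∃ φ : ModPm (SigmaGroup ι) ≃* ModPm (SO0Rat (hyp (gram σ B))),
      ∀ (M : SigmaGroup ι) (ℓ : ℕ) (L : Matrix (Fin 2) (Fin 2) (𝓞 K)), IsRep ι M ℓ L →
        ∃ U : SO0Rat (hyp (gram σ B)),
          ((U : Matrix.SpecialLinearGroup (Fin 4) ℚ) : Matrix (Fin 4) (Fin 4) ℚ) =
            tildeMat σ B ℓ L ∧
          φ (QuotientGroup.mk M) = QuotientGroup.mk U := by
  obtain ⟨φ, hφ⟩ := exists_mulEquiv_of_rel ((pmOne 2 ℝ).subgroupOf (SigmaGroup ι))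
    ((pmOne 4 ℚ).subgroupOf (SO0Rat (hyp (gram σ B))))
    (fun M U => ∃ (ℓ : ℕ) (L : Matrix (Fin 2) (Fin 2) (𝓞 K)), IsRep ι M ℓ L ∧
      U.1.1 = tildeMat σ B ℓ L)
    (by
      rintro ⟨M, ℓ, L, h⟩
      obtain ⟨U, hU⟩ := exists_mem_SO0Rat B hK hσ h
      exact ⟨U, ℓ, L, h, hU⟩)
    (by
      intro U
      obtain ⟨M, ℓ, L, h, hU⟩ := exists_isRep_of_mem_SO0Rat B hK hσ ι U.2
      exact ⟨⟨M, ℓ, L, h⟩, ℓ, L, h, hU.symm⟩)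
    (by
      rintro M U N V ⟨k, L, h, hU⟩ ⟨ℓ, P, h', hV⟩
      refine ⟨k * ℓ, L * P, ⟨Nat.mul_pos h.1 h'.1, ?_⟩, ?_⟩
      · change M.1.1 * N.1.1 = _
        rw [h.2, h'.2, realMat_mul, smul_mul_smul_comm, Nat.cast_mul,
          Real.sqrt_mul (Nat.cast_nonneg _), div_mul_div_comm, one_mul]
      · change U.1.1 * V.1.1 = _
        rw [hU, hV, tildeMat_mul B hK hσ])
    (by
      rintro M U ⟨ℓ, L, h, hU⟩
      rw [Subgroup.mem_subgroupOf, Subgroup.mem_subgroupOf, mem_pmOne_iff_tildeMat B hK hσ h, ← hU]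
      rfl)
  refine ⟨φ, fun M ℓ L h => ?_⟩
  obtain ⟨U, hU⟩ := exists_mem_SO0Rat B hK hσ h
  exact ⟨U, hU, hφ _ _ ⟨ℓ, L, h, hU⟩⟩

end Rational

/-! ### The Hurwitz-Maass extension and integrality -/

section Integral

variable {K : Type*} [Field K]

lemma entryIdeal_smul (q : 𝓞 K) (L : Matrix (Fin 2) (Fin 2) (𝓞 K)) :
    entryIdeal (q • L) = Ideal.span {q} * entryIdeal L := by
  rw [entryIdeal, entryIdeal, Ideal.span_mul_span', Set.singleton_mul, ← Set.range_comp]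
  rfl

lemma det_mem_entryIdeal_sq (L : Matrix (Fin 2) (Fin 2) (𝓞 K)) : L.det ∈ entryIdeal L ^ 2 := by
  rw [det_fin_two, pow_two]
  exact sub_mem (Ideal.mul_mem_mul (entry_mem L 0 0) (entry_mem L 1 1))
    (Ideal.mul_mem_mul (entry_mem L 0 1) (entry_mem L 1 0))

variable [NumberField K] {σ : K ≃ₐ[ℚ] K} (B : Module.Basis (Fin 2) ℤ (𝓞 K))

/-- Any two integral matrices representing M are proportional; clearing the proportionality factor
by an entry scales both I(L)² and det L by a square. The ideal condition is thus independent of the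
representative, and here det L = ℓ. -/
lemma mem_HurwitzMaass_iff {ι : K →+* ℝ}
    {M : Matrix.SpecialLinearGroup (Fin 2) ℝ} {ℓ : ℕ} {L : Matrix (Fin 2) (Fin 2) (𝓞 K)}
    (h : IsRep ι M ℓ L) :
    M ∈ HurwitzMaass ι σ ↔ entryIdeal L ^ 2 = Ideal.span {(ℓ : 𝓞 K)} := by
  have h0 : (0 : ℝ) < ℓ := Nat.cast_pos.mpr h.1
  have hd := det_of_isRep h
  constructor
  · rintro ⟨L₀, p₀, -, i₀, e₀⟩
    have hs : √(ι (L₀.det : K)) ≠ 0 := (Real.sqrt_pos.mpr p₀).ne'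
    have hs' : √(ℓ : ℝ) ≠ 0 := (Real.sqrt_pos.mpr h0).ne'
    have hp : ∀ i j, ι (L i j : K) * √(ι (L₀.det : K)) = ι (L₀ i j : K) * √(ℓ : ℝ) := by
      intro i j
      have h1 := congrFun (congrFun h.2 i) j
      have h2 := congrFun (congrFun e₀ i) j
      rw [h1] at h2
      simp [realMat] at h2
      field_simp at h2
      linear_combination h2
    obtain ⟨k, l, hkl⟩ : ∃ k l, L₀ k l ≠ 0 := by
      by_contra! h'
      have : L₀.det = 0 := by simp [det_fin_two, h']
      simp [this] at p₀
    have hL : L₀ k l • L = L k l • L₀ := by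
      ext i j
      have : (ι (L₀ k l : K) * ι (L i j : K)) = (ι (L k l : K) * ι (L₀ i j : K)) := by
        refine mul_right_cancel₀ (mul_ne_zero hs hs') ?_
        linear_combination √(ℓ : ℝ) * ι (L₀ k l : K) * hp i j - √(ℓ : ℝ) * ι (L₀ i j : K) * hp k l
      have h3 : (L₀ k l : K) * (L i j : K) = (L k l : K) * (L₀ i j : K) :=
        ι.injective (by rw [map_mul, map_mul, this])
      simpa using h3
    have hI := congrArg entryIdeal hL
    rw [entryIdeal_smul, entryIdeal_smul] at hI
    have hI2 := congrArg (fun J => J ^ 2) hI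
    have hdet := congrArg Matrix.det hL
    rw [det_smul, det_smul, Fintype.card_fin, hd] at hdet
    simp only [mul_pow, i₀, Ideal.span_singleton_pow, Ideal.span_singleton_mul_span_singleton,
      ← hdet] at hI2
    rw [← Ideal.span_singleton_mul_span_singleton] at hI2
    refine mul_left_cancel₀ ?_ hI2
    rw [Ne, Ideal.zero_eq_bot, Ideal.span_singleton_eq_bot]
    exact pow_ne_zero 2 hkl
  · intro hI
    have hdK : (L.det : K) = ℓ := by rw [hd]; simp
    refine ⟨L, ?_, ?_, ?_, ?_⟩
    · rw [hdK, map_natCast]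
      exact h0
    · rw [hdK, map_natCast, map_natCast]
      exact h0
    · rw [hI, hd]
    · rw [hdK, map_natCast]
      exact h.2

/-- The Galois conjugation on the ring of integers. -/
def conjInt (σ : K ≃ₐ[ℚ] K) : 𝓞 K ≃+* 𝓞 K := RingOfIntegers.mapRingEquiv (σ : K ≃+* K)

lemma coe_conjInt (x : 𝓞 K) : (conjInt σ x : K) = σ (x : K) := rfl

lemma conjInt_conjInt (hK : Module.finrank ℚ K = 2) (hσ : σ ≠ 1) (x : 𝓞 K) :
    conjInt σ (conjInt σ x) = x :=
  RingOfIntegers.ext (conj_conj hK hσ x)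

/-- From I(L)² = (det L) and total positivity, det L has norm n² with n the norm of I(L). Hence L
can be rescaled to have rational determinant. -/
lemma HurwitzMaass_le_SigmaGroup (hK : Module.finrank ℚ K = 2) (hσ : σ ≠ 1) (ι : K →+* ℝ) :
    HurwitzMaass ι σ ≤ SigmaGroup ι := by
  rintro M ⟨L, hp, hq, hI, hM⟩
  set n : ℕ := Ideal.absNorm (entryIdeal L) with hn
  have hnorm : (L.det : K) * σ (L.det : K) = (n : K) ^ 2 := by
    have h1 : n ^ 2 = (Algebra.norm ℤ L.det).natAbs := by
      rw [hn, ← map_pow, hI, Ideal.absNorm_span_singleton]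
    have h2 : ((Algebra.norm ℤ L.det : ℤ) : K) = (L.det : K) * σ (L.det : K) := by
      rw [← norm_eq hK hσ, ← Algebra.coe_norm_int]
      simp
    have h3 : 0 < Algebra.norm ℤ L.det := by
      have h4 : ((Algebra.norm ℤ L.det : ℤ) : ℝ) = ι (L.det : K) * ι (σ (L.det : K)) := by
        rw [← map_mul, ← h2, map_intCast]
      have h5 : (0 : ℝ) < (Algebra.norm ℤ L.det : ℤ) := by
        rw [h4]
        exact mul_pos hp hq
      exact_mod_cast h5
    have h6 : ((n ^ 2 : ℕ) : ℤ) = Algebra.norm ℤ L.det := by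
      rw [h1, Int.natCast_natAbs, abs_of_pos h3]
    rw [← h2, ← h6]
    push_cast
    rfl
  -- With d = det L and d d' = n² one has μ² d = n² (d + d' + 2n), an integer; and μ > 0 gives √(μ²
  -- d) = μ √d.
  set μ : 𝓞 K := n + conjInt σ L.det with hμ
  have hμK : (μ : K) = n + σ (L.det : K) := by
    rw [hμ]
    simp [coe_conjInt]
  have hμpos : 0 < ι (μ : K) := by
    rw [hμK, map_add, map_natCast]
    positivity
  have hdet : ((μ • L).det : K) = (μ : K) ^ 2 * (L.det : K) := by
    rw [det_smul, Fintype.card_fin]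
    simp
  obtain ⟨m, hm⟩ := exists_int_of_conj_eq hK hσ (x := (μ • L).det) (by
    rw [hdet, map_mul, map_pow, hμK, map_add, map_natCast, conj_conj hK hσ]
    linear_combination ((L.det : K) - σ (L.det : K)) * hnorm)
  have hmR : (m : ℝ) = ι (μ : K) ^ 2 * ι (L.det : K) := by
    rw [← map_pow, ← map_mul, ← hdet, hm]
    simp
  have hm0 : 0 < m := by
    have : (0 : ℝ) < m := by
      rw [hmR]
      positivity
    exact_mod_cast this
  lift m to ℕ using hm0.le with ℓ
  refine ⟨ℓ, μ • L, by exact_mod_cast hm0, ?_⟩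
  have hs : √(ℓ : ℝ) = ι (μ : K) * √(ι (L.det : K)) := by
    rw [← Int.cast_natCast, hmR, Real.sqrt_mul (sq_nonneg _), Real.sqrt_sq hμpos.le]
  rw [hM, hs]
  ext i j
  simp [realMat]
  field_simp

/-- u/ℓ is a root of the monic polynomial X² - sX + r with s = (u + v)/ℓ and r = u v/ℓ², and the
ring of integers is integrally closed. -/
lemma dvd_of_dvd_add_of_sq_dvd_mul {ℓ u v : 𝓞 K} (hℓ : ℓ ≠ 0) (h1 : ℓ ∣ u + v)
    (h2 : ℓ ^ 2 ∣ u * v) : ℓ ∣ u := by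
  obtain ⟨s, hs⟩ := h1
  obtain ⟨r, hr⟩ := h2
  have hℓ' : (ℓ : K) ≠ 0 := RingOfIntegers.coe_ne_zero_iff.mpr hℓ
  have hs' : (u : K) + v = ℓ * s := by
    have := congrArg (fun x : 𝓞 K => (x : K)) hs
    simpa using this
  have hr' : (u : K) * v = ℓ ^ 2 * r := by
    have := congrArg (fun x : 𝓞 K => (x : K)) hr
    simpa using this
  have hi : IsIntegral (𝓞 K) ((u : K) / ℓ) := by
    refine ⟨Polynomial.X ^ 2 - Polynomial.C s * Polynomial.X + Polynomial.C r, by monicity!, ?_⟩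
    simp only [Polynomial.eval₂_add, Polynomial.eval₂_sub, Polynomial.eval₂_mul,
      Polynomial.eval₂_pow, Polynomial.eval₂_X, Polynomial.eval₂_C]
    field_simp
    linear_combination (u : K) * hs' - hr'
  obtain ⟨y, hy⟩ := IsIntegrallyClosed.isIntegral_iff.mp hi
  refine ⟨y, RingOfIntegers.ext ?_⟩
  rw [eq_div_iff hℓ'] at hy
  simpa [mul_comm] using hy.symm

/-- All products of an entry of `L` with a conjugate of an entry are divisible by `ℓ`. -/
def ConjDvd (σ : K ≃ₐ[ℚ] K) (ℓ : ℕ) (L : Matrix (Fin 2) (Fin 2) (𝓞 K)) : Prop :=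
  ∀ i j k l, (ℓ : 𝓞 K) ∣ L i j * conjInt σ (L k l)

/-- ℓ divides the square of every entry and of its conjugate, so ℓ² divides (x y')²; square roots
may be taken in an integrally closed ring. -/
lemma conjDvd_of_sq_eq {ℓ : ℕ}
    {L : Matrix (Fin 2) (Fin 2) (𝓞 K)} (hI : entryIdeal L ^ 2 = Ideal.span {(ℓ : 𝓞 K)}) :
    ConjDvd σ ℓ L := by
  have h1 : ∀ i j, (ℓ : 𝓞 K) ∣ L i j ^ 2 := by
    intro i j
    rw [← Ideal.mem_span_singleton, ← hI]
    exact Ideal.pow_mem_pow (entry_mem L i j) 2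
  intro i j k l
  rw [← IsIntegrallyClosed.pow_dvd_pow_iff two_ne_zero, mul_pow, pow_two]
  refine mul_dvd_mul (h1 i j) ?_
  have := map_dvd (conjInt σ) (h1 k l)
  rwa [map_natCast, map_pow] at this

/-- Write I = I(L). Then I I' ⊆ (ℓ) = (det L) ⊆ I²; cancelling I gives I' ⊆ I, conjugating gives I ⊆
I', and so I² ⊆ I I' ⊆ (ℓ). -/
lemma sq_eq_of_conjDvd (hK : Module.finrank ℚ K = 2) (hσ : σ ≠ 1) {ℓ : ℕ} (hℓ : 0 < ℓ)
    {L : Matrix (Fin 2) (Fin 2) (𝓞 K)} (hd : L.det = ℓ) (h : ConjDvd σ ℓ L) :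
    entryIdeal L ^ 2 = Ideal.span {(ℓ : 𝓞 K)} := by
  have hle : Ideal.span {(ℓ : 𝓞 K)} ≤ entryIdeal L ^ 2 := by
    rw [Ideal.span_singleton_le_iff_mem, ← hd]
    exact det_mem_entryIdeal_sq L
  have hI0 : entryIdeal L ≠ 0 := by
    intro h0
    rw [h0, zero_pow two_ne_zero, Ideal.zero_eq_bot, le_bot_iff, Ideal.span_singleton_eq_bot] at hle
    exact hℓ.ne' (by exact_mod_cast hle)
  have hII : entryIdeal L * (entryIdeal L).map (conjInt σ) ≤ Ideal.span {(ℓ : 𝓞 K)} := by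
    rw [entryIdeal, Ideal.map_span, Ideal.span_mul_span', Ideal.span_le]
    rintro _ ⟨_, ⟨p, rfl⟩, _, ⟨_, ⟨q, rfl⟩, rfl⟩, rfl⟩
    exact Ideal.mem_span_singleton.mpr (h p.1 p.2 q.1 q.2)
  have hc : (entryIdeal L).map (conjInt σ) ≤ entryIdeal L := by
    have := hII.trans hle
    rw [← Ideal.dvd_iff_le, pow_two] at this
    exact Ideal.dvd_iff_le.mp ((mul_dvd_mul_iff_left hI0).mp this)
  refine le_antisymm ?_ hle
  rw [pow_two, Ideal.mul_le]
  intro x hx y hy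
  apply hII
  refine Ideal.mul_mem_mul hx ?_
  rw [← conjInt_conjInt hK hσ y]
  exact Ideal.mem_map_of_mem _ (hc (Ideal.mem_map_of_mem _ hy))

/-- The matrix `M̃` is integral if the products of entries are divisible by `ℓ`. -/
lemma exists_int_of_conjDvd (hK : Module.finrank ℚ K = 2) (hσ : σ ≠ 1) {ℓ : ℕ} (hℓ : 0 < ℓ)
    {L : Matrix (Fin 2) (Fin 2) (𝓞 K)} (h : ConjDvd σ ℓ L) :
    ∃ U : Matrix (Fin 4) (Fin 4) ℤ, U.map (Int.cast : ℤ → ℚ) = tildeMat σ B ℓ L := by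
  have hℓ' : (ℓ : K) ≠ 0 := Nat.cast_ne_zero.mpr hℓ.ne'
  have hm : ∀ i j k l, ∃ w : 𝓞 K, (L i j : K) * σ (L k l : K) / (ℓ : K) = w := by
    intro i j k l
    obtain ⟨w, hw⟩ := h i j k l
    refine ⟨w, ?_⟩
    rw [div_eq_iff hℓ', ← coe_conjInt, ← map_mul, hw]
    simp [mul_comm]
  have hn : ∀ i j, ∃ n : ℤ, (n : ℚ) = Algebra.norm ℚ (L i j : K) / (ℓ : ℚ) := by
    intro i j
    obtain ⟨w, hw⟩ := hm i j i j
    obtain ⟨n, rfl⟩ := exists_int_of_conj_eq hK hσ (x := w) (by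
      rw [← hw]
      simp [conj_conj hK hσ, mul_comm])
    refine ⟨n, ?_⟩
    have : ((n : ℚ) : K) = ((Algebra.norm ℚ (L i j : K) / (ℓ : ℚ) : ℚ) : K) := by
      push_cast
      rw [norm_eq hK hσ, hw]
      simp
    exact Rat.cast_injective this
  have hc : ∀ (i j k l s : Fin 2), ∃ n : ℤ,
      (n : ℚ) = coords B ((L i j : K) * σ (L k l : K) / (ℓ : K)) s := by
    intro i j k l s
    obtain ⟨w, hw⟩ := hm i j k l
    exact ⟨_, by rw [hw, coords_int]⟩
  have hneg : ∀ (x : K) (s : Fin 2), coords B (-x) s = -coords B x s := by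
    intro x s
    simp [coords]
  have he : ∀ s t, ∃ n : ℤ, (n : ℚ) = endoMat σ B ((L 0 0 : K) * σ (L 1 1 : K) / (ℓ : K))
      ((L 0 1 : K) * σ (L 1 0 : K) / (ℓ : K)) s t := by
    intro s t
    obtain ⟨w, hw⟩ := hm 0 0 1 1
    obtain ⟨w', hw'⟩ := hm 0 1 1 0
    refine ⟨B.repr (w * B t + w' * conjInt σ (B t)) s, ?_⟩
    rw [← coords_int, hw, hw']
    simp [endoMat, LinearMap.toMatrix_apply, coords, ratBasis_apply, coe_conjInt]
  choose n hn using hn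
  choose c hc using hc
  choose e he using he
  refine ⟨!![n 0 0, -(c 0 1 0 0 0 * gram σ B 0 0 + c 0 1 0 0 1 * gram σ B 1 0),
      -(c 0 1 0 0 0 * gram σ B 0 1 + c 0 1 0 0 1 * gram σ B 1 1), -n 0 1;
    -c 0 0 1 0 0, e 0 0, e 0 1, c 0 1 1 1 0;
    -c 0 0 1 0 1, e 1 0, e 1 1, c 0 1 1 1 1;
    -n 1 0, c 1 1 1 0 0 * gram σ B 0 0 + c 1 1 1 0 1 * gram σ B 1 0,
      c 1 1 1 0 0 * gram σ B 0 1 + c 1 1 1 0 1 * gram σ B 1 1, n 1 1], ?_⟩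
  ext i j
  fin_cases i <;> fin_cases j <;>
    simp [tildeMat, hn, hc, he, hneg, Matrix.vecMul, dotProduct, Fin.sum_univ_two]

end Integral

/-! ### From integrality of M̃ back to ideals -/

section Integral

variable {K : Type*} [Field K] [NumberField K] {σ : K ≃ₐ[ℚ] K}
  (B : Module.Basis (Fin 2) ℤ (𝓞 K))

lemma dvd_of_coe_eq {ℓ : ℕ} (hℓ : 0 < ℓ) {x y w : 𝓞 K}
    (h : (x : K) * σ (y : K) / (ℓ : K) = w) : (ℓ : 𝓞 K) ∣ x * conjInt σ y := by
  have hℓ' : (ℓ : K) ≠ 0 := Nat.cast_ne_zero.mpr hℓ.ne'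
  refine ⟨w, RingOfIntegers.ext ?_⟩
  rw [div_eq_iff hℓ'] at h
  simpa [coe_conjInt, mul_comm] using h

lemma coe_of_coords {x : K} {n : Fin 2 → ℤ} (h : ∀ i, (n i : ℚ) = coords B x i) :
    x = ((n 0 * B 0 + n 1 * B 1 : 𝓞 K) : K) := by
  rw [← coords_sum B x, ← h, ← h]
  simp

/-- The columns of the central block of `M̃`. -/
lemma central_col {ℓ : ℕ} {L : Matrix (Fin 2) (Fin 2) (𝓞 K)} {U : Matrix (Fin 4) (Fin 4) ℤ}
    (hU : U.map (Int.cast : ℤ → ℚ) = tildeMat σ B ℓ L) (j : Fin 2) :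
    (L 0 0 : K) * σ (L 1 1 : K) / (ℓ : K) * (B j : K) +
      (L 0 1 : K) * σ (L 1 0 : K) / (ℓ : K) * σ (B j : K) =
        U 1 (![1, 2] j) * (B 0 : K) + U 2 (![1, 2] j) * (B 1 : K) := by
  have h : ∀ i j, (U i j : ℚ) = tildeMat σ B ℓ L i j := fun i j => congrFun (congrFun hU i) j
  rw [← endoMat_col]
  have h1 : (endoMat σ B ((L 0 0 : K) * σ (L 1 1 : K) / (ℓ : K))
      ((L 0 1 : K) * σ (L 1 0 : K) / (ℓ : K)) 0 j) = U 1 (![1, 2] j) := by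
    rw [h]
    fin_cases j <;> simp [tildeMat]
  have h2 : (endoMat σ B ((L 0 0 : K) * σ (L 1 1 : K) / (ℓ : K))
      ((L 0 1 : K) * σ (L 1 0 : K) / (ℓ : K)) 1 j) = U 2 (![1, 2] j) := by
    rw [h]
    fin_cases j <;> simp [tildeMat]
  rw [h1, h2]
  simp

/-- These products come from the corners, the columns b and c, and the central block evaluated at w
= 1. The entries aᵗʳS and dᵗʳS are left aside, since S need not be invertible over ℤ. -/
lemma dvd_of_int (hK : Module.finrank ℚ K = 2) (hσ : σ ≠ 1) {ℓ : ℕ} (hℓ : 0 < ℓ)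
    {L : Matrix (Fin 2) (Fin 2) (𝓞 K)} {U : Matrix (Fin 4) (Fin 4) ℤ}
    (hU : U.map (Int.cast : ℤ → ℚ) = tildeMat σ B ℓ L) :
    (∀ i j, (ℓ : 𝓞 K) ∣ L i j * conjInt σ (L i j)) ∧ (ℓ : 𝓞 K) ∣ L 0 0 * conjInt σ (L 1 0) ∧
      (ℓ : 𝓞 K) ∣ L 0 1 * conjInt σ (L 1 1) ∧
      (ℓ : 𝓞 K) ∣ L 0 0 * conjInt σ (L 1 1) + L 0 1 * conjInt σ (L 1 0) := by
  have hℓ' : (ℓ : K) ≠ 0 := Nat.cast_ne_zero.mpr hℓ.ne'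
  have h : ∀ i j, (U i j : ℚ) = tildeMat σ B ℓ L i j := fun i j => congrFun (congrFun hU i) j
  have hn : ∀ (x : 𝓞 K) (n : ℤ), (n : ℚ) = Algebra.norm ℚ (x : K) / (ℓ : ℚ) →
      (ℓ : 𝓞 K) ∣ x * conjInt σ x := by
    intro x n hx
    refine dvd_of_coe_eq hℓ (w := n) ?_
    have := congrArg (Rat.cast : ℚ → K) hx
    push_cast at this
    rw [norm_eq hK hσ] at this
    simpa using this.symm
  refine ⟨?_, ?_, ?_, ?_⟩
  · have h1 := hn (L 0 0) (U 0 0) (by simp [h, tildeMat])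
    have h2 := hn (L 0 1) (-U 0 3) (by simp [h, tildeMat])
    have h3 := hn (L 1 0) (-U 3 0) (by simp [h, tildeMat])
    have h4 := hn (L 1 1) (U 3 3) (by simp [h, tildeMat])
    intro i j
    fin_cases i <;> fin_cases j <;> assumption
  · have := coe_of_coords B (x := -((L 0 0 : K) * σ (L 1 0 : K) / (ℓ : K)))
      (n := ![U 1 0, U 2 0]) (by
        intro i
        fin_cases i <;> simp [h, tildeMat])
    rw [neg_eq_iff_eq_neg] at this
    refine dvd_of_coe_eq hℓ (w := -(U 1 0 * B 0 + U 2 0 * B 1)) ?_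
    rw [this]
    simp
  · exact dvd_of_coe_eq hℓ (coe_of_coords B (x := (L 0 1 : K) * σ (L 1 1 : K) / (ℓ : K))
      (n := ![U 1 3, U 2 3]) (by
        intro i
        fin_cases i <;> simp [h, tildeMat]))
  · have c0 := central_col B hU 0
    have c1 := central_col B hU 1
    -- The coordinates of 1 combine the two columns of the central block into its value at w = 1.
    have h1 : (B.repr 1 0 : K) * (B 0 : K) + (B.repr 1 1 : K) * (B 1 : K) = 1 := by
      have := coords_sum B ((1 : 𝓞 K) : K)
      rw [coords_int, coords_int] at this
      simpa using this
    have h1' := congrArg σ h1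
    simp only [map_add, map_mul, map_intCast, map_one] at h1'
    refine ⟨B.repr 1 0 * (U 1 1 * B 0 + U 2 1 * B 1) + B.repr 1 1 * (U 1 2 * B 0 + U 2 2 * B 1),
      RingOfIntegers.ext ?_⟩
    simp at c0 c1
    simp [coe_conjInt]
    field_simp at c0 c1
    linear_combination (B.repr 1 0 : K) * c0 + (B.repr 1 1 : K) * c1 -
      (L 0 0 : K) * σ (L 1 1 : K) * h1 - (L 0 1 : K) * σ (L 1 0 : K) * h1'

lemma tildeMat_scalar (hK : Module.finrank ℚ K = 2) (hσ : σ ≠ 1) {g : ℕ} (hg : 0 < g) :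
    tildeMat σ B (g ^ 2) ((g : 𝓞 K) • 1) = 1 := by
  have := (tildeMat_eq_smul_one_iff B hK hσ (pow_pos hg 2)
    ((g : 𝓞 K) • (1 : Matrix (Fin 2) (Fin 2) (𝓞 K))) (ε := 1) one_ne_zero).mpr (by
      simp [pow_two])
  rwa [one_smul] at this

/-- If `M̃` is integral of determinant one, then the products of entries are divisible by `ℓ`. -/
lemma conjDvd_of_int (hK : Module.finrank ℚ K = 2) (hσ : σ ≠ 1) {ℓ : ℕ} (hℓ : 0 < ℓ)
    {L : Matrix (Fin 2) (Fin 2) (𝓞 K)} (hd : L.det = ℓ) (U : Matrix.SpecialLinearGroup (Fin 4) ℤ)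
    (hU : U.1.map (Int.cast : ℤ → ℚ) = tildeMat σ B ℓ L) : ConjDvd σ ℓ L := by
  -- The inverse belongs to the adjugate of L, and its columns b and c supply the products hidden
  -- behind S in M̃.
  have hinv : (U⁻¹).1.map (Int.cast : ℤ → ℚ) = tildeMat σ B ℓ L.adjugate := by
    have h1 : tildeMat σ B ℓ L.adjugate * tildeMat σ B ℓ L = 1 := by
      rw [← tildeMat_mul B hK hσ, adjugate_mul, hd, ← pow_two, tildeMat_scalar B hK hσ hℓ]
    have h2 : tildeMat σ B ℓ L * (U⁻¹).1.map (Int.cast : ℤ → ℚ) = 1 := by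
      have h3 : U.1 * (U⁻¹).1 = 1 := congrArg Subtype.val (mul_inv_cancel U)
      have h4 : (U.1 * (U⁻¹).1).map (Int.cast : ℤ → ℚ) =
          U.1.map (Int.cast : ℤ → ℚ) * (U⁻¹).1.map (Int.cast : ℤ → ℚ) :=
        Matrix.map_mul (f := Int.castRingHom ℚ)
      rw [← hU, ← h4, h3]
      simp
    exact (left_inv_eq_right_inv h1 h2).symm
  obtain ⟨n, a, b, e⟩ := dvd_of_int B hK hσ hℓ hU
  obtain ⟨-, c, d, -⟩ := dvd_of_int B hK hσ hℓ hinv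
  rw [adjugate_fin_two] at c d
  simp at c d
  have flip : ∀ x y : 𝓞 K, (ℓ : 𝓞 K) ∣ x * conjInt σ y → (ℓ : 𝓞 K) ∣ y * conjInt σ x := by
    intro x y h
    have := map_dvd (conjInt σ) h
    rwa [map_natCast, map_mul, conjInt_conjInt hK hσ, mul_comm] at this
  have hℓ0 : (ℓ : 𝓞 K) ≠ 0 := Nat.cast_ne_zero.mpr hℓ.ne'
  -- Only the sum αδ' + βγ' is known to be divisible by ℓ. Its terms have product (αγ')(βδ'),
  -- divisible by ℓ², which separates them.
  have hp : (ℓ : 𝓞 K) ^ 2 ∣ (L 0 0 * conjInt σ (L 1 1)) * (L 0 1 * conjInt σ (L 1 0)) := by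
    have := mul_dvd_mul a b
    rw [← pow_two] at this
    convert this using 1
    ring
  have f : (ℓ : 𝓞 K) ∣ L 0 0 * conjInt σ (L 1 1) := dvd_of_dvd_add_of_sq_dvd_mul hℓ0 e hp
  have g : (ℓ : 𝓞 K) ∣ L 0 1 * conjInt σ (L 1 0) := (dvd_add_right f).mp e
  have a' := flip _ _ a
  have b' := flip _ _ b
  have c' := flip _ _ c
  have d' := flip _ _ d
  have f' := flip _ _ f
  have g' := flip _ _ g
  have n00 := n 0 0
  have n01 := n 0 1
  have n10 := n 1 0
  have n11 := n 1 1
  intro i j k l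
  fin_cases i <;> fin_cases j <;> fin_cases k <;> fin_cases l <;> assumption

lemma mem_SO0Int_iff {n : ℕ} {T : Matrix (Fin n) (Fin n) ℤ} (U : Matrix.SpecialLinearGroup (Fin n) ℤ) :
    U ∈ SO0Int T ↔ Matrix.SpecialLinearGroup.map (Int.castRingHom ℚ) U ∈ SO0Rat T := by
  have : Matrix.SpecialLinearGroup.map (Int.castRingHom ℝ) U =
      Matrix.SpecialLinearGroup.map (algebraMap ℚ ℝ)
        (Matrix.SpecialLinearGroup.map (Int.castRingHom ℚ) U) := by
    ext i j
    simp
  change Matrix.SpecialLinearGroup.map (Int.castRingHom ℝ) U ∈ SO0Real T ↔ _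
  rw [this]
  rfl

lemma mem_pmOne_map_iff {n : ℕ} (U : Matrix.SpecialLinearGroup (Fin n) ℤ) :
    U ∈ pmOne n ℤ ↔ U.1.map (Int.cast : ℤ → ℚ) = 1 ∨ U.1.map (Int.cast : ℤ → ℚ) = -1 := by
  have hinj := Matrix.map_injective (m := Fin n) (n := Fin n) (Int.cast_injective (α := ℚ))
  have h1 : (1 : Matrix (Fin n) (Fin n) ℤ).map (Int.cast : ℤ → ℚ) = 1 := by simp
  have h2 : (-1 : Matrix (Fin n) (Fin n) ℤ).map (Int.cast : ℤ → ℚ) = -1 := by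
    rw [Matrix.map_neg _ (by simp), h1]
  change U.1 = 1 ∨ U.1 = -1 ↔ _
  rw [← hinj.eq_iff, ← hinj.eq_iff (a := U.1) (b := -1), h1, h2]

/-- An integral `M̃` belongs to the integral orthogonal group. -/
lemma exists_mem_SO0Int (hK : Module.finrank ℚ K = 2) (hσ : σ ≠ 1) {ι : K →+* ℝ}
    {M : Matrix.SpecialLinearGroup (Fin 2) ℝ} {ℓ : ℕ} {L : Matrix (Fin 2) (Fin 2) (𝓞 K)}
    (h : IsRep ι M ℓ L) (hI : ConjDvd σ ℓ L) :
    ∃ U : SO0Int (hyp (gram σ B)), U.1.1.map (Int.cast : ℤ → ℚ) = tildeMat σ B ℓ L := by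
  obtain ⟨U, hU⟩ := exists_int_of_conjDvd B hK hσ h.1 hI
  obtain ⟨V, hV⟩ := exists_mem_SO0Rat B hK hσ h
  have hd : U.det = 1 := by
    have e : (U.map (Int.cast : ℤ → ℚ)).det = ((U.det : ℤ) : ℚ) :=
      ((Int.castRingHom ℚ).map_det U).symm
    rw [hU, det_tildeMat B hK hσ h] at e
    exact_mod_cast e.symm
  obtain ⟨W, rfl⟩ : ∃ W : Matrix.SpecialLinearGroup (Fin 4) ℤ, W.1 = U := ⟨⟨U, hd⟩, rfl⟩
  refine ⟨⟨W, ?_⟩, hU⟩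
  have : Matrix.SpecialLinearGroup.map (Int.castRingHom ℚ) W = V.1 :=
    Subtype.ext (hU.trans hV.symm)
  rw [mem_SO0Int_iff, this]
  exact V.2

lemma exists_isRep_of_mem_SO0Int (hK : Module.finrank ℚ K = 2) (hσ : σ ≠ 1) (ι : K →+* ℝ)
    {U : Matrix.SpecialLinearGroup (Fin 4) ℤ} (hU : U ∈ SO0Int (hyp (gram σ B))) :
    ∃ (M : Matrix.SpecialLinearGroup (Fin 2) ℝ) (ℓ : ℕ) (L : Matrix (Fin 2) (Fin 2) (𝓞 K)),
      IsRep ι M ℓ L ∧ U.1.map (Int.cast : ℤ → ℚ) = tildeMat σ B ℓ L := by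
  rw [mem_SO0Int_iff] at hU
  obtain ⟨M, ℓ, L, h, e⟩ := exists_isRep_of_mem_SO0Rat B hK hσ ι hU
  exact ⟨M, ℓ, L, h, e.symm⟩

/-- The isomorphism of the Hurwitz-Maass extension with the integral orthogonal group, modulo
signs. -/
theorem exists_mulEquiv_SO0Int (hK : Module.finrank ℚ K = 2) (hσ : σ ≠ 1) (ι : K →+* ℝ) :
    ∃ ψ : ModPm (HurwitzMaass ι σ) ≃* ModPm (SO0Int (hyp (gram σ B))),
      ∀ (M : HurwitzMaass ι σ) (ℓ : ℕ) (L : Matrix (Fin 2) (Fin 2) (𝓞 K)), IsRep ι M ℓ L →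
        ∃ U : SO0Int (hyp (gram σ B)),
          ((U : Matrix.SpecialLinearGroup (Fin 4) ℤ) : Matrix (Fin 4) (Fin 4) ℤ).map
            (Int.cast : ℤ → ℚ) = tildeMat σ B ℓ L ∧
          ψ (QuotientGroup.mk M) = QuotientGroup.mk U := by
  have tot : ∀ (M : HurwitzMaass ι σ) (ℓ : ℕ) (L : Matrix (Fin 2) (Fin 2) (𝓞 K)), IsRep ι M ℓ L →
      ∃ U : SO0Int (hyp (gram σ B)), U.1.1.map (Int.cast : ℤ → ℚ) = tildeMat σ B ℓ L :=
    fun M ℓ L h =>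
      exists_mem_SO0Int B hK hσ h (conjDvd_of_sq_eq ((mem_HurwitzMaass_iff h).mp M.2))
  obtain ⟨ψ, hψ⟩ := exists_mulEquiv_of_rel ((pmOne 2 ℝ).subgroupOf (HurwitzMaass ι σ))
    ((pmOne 4 ℤ).subgroupOf (SO0Int (hyp (gram σ B))))
    (fun M U => ∃ (ℓ : ℕ) (L : Matrix (Fin 2) (Fin 2) (𝓞 K)), IsRep ι M ℓ L ∧
      U.1.1.map (Int.cast : ℤ → ℚ) = tildeMat σ B ℓ L)
    (by
      intro M
      obtain ⟨ℓ, L, h⟩ := HurwitzMaass_le_SigmaGroup hK hσ ι M.2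
      obtain ⟨U, hU⟩ := tot M ℓ L h
      exact ⟨U, ℓ, L, h, hU⟩)
    (by
      intro U
      obtain ⟨M, ℓ, L, h, hU⟩ := exists_isRep_of_mem_SO0Int B hK hσ ι U.2
      have hM : M ∈ HurwitzMaass ι σ := by
        rw [mem_HurwitzMaass_iff h]
        exact sq_eq_of_conjDvd hK hσ h.1 (det_of_isRep h)
          (conjDvd_of_int B hK hσ h.1 (det_of_isRep h) U.1 hU)
      exact ⟨⟨M, hM⟩, ℓ, L, h, hU⟩)
    (by
      rintro M U N V ⟨k, L, h, hU⟩ ⟨ℓ, P, h', hV⟩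
      refine ⟨k * ℓ, L * P, ⟨Nat.mul_pos h.1 h'.1, ?_⟩, ?_⟩
      · change M.1.1 * N.1.1 = _
        rw [h.2, h'.2, realMat_mul, smul_mul_smul_comm, Nat.cast_mul,
          Real.sqrt_mul (Nat.cast_nonneg _), div_mul_div_comm, one_mul]
      · rw [tildeMat_mul B hK hσ, ← hU, ← hV]
        exact Matrix.map_mul (f := Int.castRingHom ℚ))
    (by
      rintro M U ⟨ℓ, L, h, hU⟩
      rw [Subgroup.mem_subgroupOf, Subgroup.mem_subgroupOf, mem_pmOne_iff_tildeMat B hK hσ h, ← hU,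
        mem_pmOne_map_iff])
  refine ⟨ψ, fun M ℓ L h => ?_⟩
  obtain ⟨U, hU⟩ := tot M ℓ L h
  exact ⟨U, hU, hψ _ _ ⟨ℓ, L, h, hU⟩⟩

end Integral

/-! ### The discriminant kernel -/

section Discriminant

variable {K : Type*} [Field K] [NumberField K] {σ : K ≃ₐ[ℚ] K}
  (B : Module.Basis (Fin 2) ℤ (𝓞 K))

lemma repr_sum (x : 𝓞 K) : (B.repr x 0 : 𝓞 K) * B 0 + (B.repr x 1 : 𝓞 K) * B 1 = x := by
  have := B.sum_repr x
  rw [Fin.sum_univ_two] at this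
  simpa using this

lemma gram_cast_int (hK : Module.finrank ℚ K = 2) (hσ : σ ≠ 1) (i j : Fin 2) :
    ((gram σ B i j : ℤ) : 𝓞 K) = B i * conjInt σ (B j) + conjInt σ (B i) * B j := by
  apply RingOfIntegers.ext
  simpa [coe_conjInt] using gram_cast B hK hσ i j

/-- Integral row vectors times S are exactly the functionals w ↦ Tr(x w') with x integral. -/
lemma sum_repr_mul_gram (hK : Module.finrank ℚ K = 2) (hσ : σ ≠ 1) (x : 𝓞 K) (j : Fin 2) :
    (B.repr x 0 : 𝓞 K) * (gram σ B 0 j : ℤ) + (B.repr x 1 : 𝓞 K) * (gram σ B 1 j : ℤ) =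
      x * conjInt σ (B j) + conjInt σ x * B j := by
  have h := repr_sum B x
  have h' := congrArg (conjInt σ) h
  simp only [map_add, map_mul, map_intCast] at h'
  rw [gram_cast_int B hK hσ, gram_cast_int B hK hσ]
  linear_combination conjInt σ (B j) * h + B j * h'

/-- For a matrix in `SL_2(𝓞 K)`, the matrix `M̃` belongs to the discriminant kernel. -/
lemma exists_eq_one_add_mul (hK : Module.finrank ℚ K = 2) (hσ : σ ≠ 1)
    {L : Matrix (Fin 2) (Fin 2) (𝓞 K)} (hd : L.det = 1) {U : Matrix (Fin 4) (Fin 4) ℤ}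
    (hU : U.map (Int.cast : ℤ → ℚ) = tildeMat σ B 1 L) :
    ∃ X : Matrix (Fin 4) (Fin 4) ℤ, U = 1 + X * hyp (gram σ B) := by
  have h : ∀ i j, (U i j : ℚ) = tildeMat σ B 1 L i j := fun i j => congrFun (congrFun hU i) j
  have hm : ∀ x y : 𝓞 K, (x : K) * σ (y : K) = ((x * conjInt σ y : 𝓞 K) : K) := by
    intro x y
    simp [coe_conjInt]
  have hneg : ∀ x : 𝓞 K, -(x : K) = ((-x : 𝓞 K) : K) := fun x => by simp
  set a : 𝓞 K := -(L 0 1 * conjInt σ (L 0 0)) with ha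
  set d : 𝓞 K := L 1 1 * conjInt σ (L 1 0) with hd'
  set y : Fin 2 → 𝓞 K := fun m => L 0 1 * B.repr (conjInt σ (L 1 0)) m + L 0 0 * B.repr (L 1 1) m -
    L 0 0 * L 1 1 * B.repr 1 m with hy
  have r0 : ∀ j, U 0 (![1, 2] j) = B.repr a 0 * gram σ B 0 j + B.repr a 1 * gram σ B 1 j := by
    intro j
    have : (U 0 (![1, 2] j) : ℚ) =
        ((B.repr a 0 * gram σ B 0 j + B.repr a 1 * gram σ B 1 j : ℤ) : ℚ) := by
      push_cast
      rw [← coords_int, ← coords_int, h, ha, ← hneg, ← hm]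
      fin_cases j <;> simp [tildeMat, Matrix.vecMul, dotProduct]
    exact_mod_cast this
  have r3 : ∀ j, U 3 (![1, 2] j) = B.repr d 0 * gram σ B 0 j + B.repr d 1 * gram σ B 1 j := by
    intro j
    have : (U 3 (![1, 2] j) : ℚ) =
        ((B.repr d 0 * gram σ B 0 j + B.repr d 1 * gram σ B 1 j : ℤ) : ℚ) := by
      push_cast
      rw [← coords_int, ← coords_int, h, hd', ← hm]
      fin_cases j <;> simp [tildeMat, Matrix.vecMul, dotProduct]
    exact_mod_cast this
  have rc : ∀ k j, U (![1, 2] k) (![1, 2] j) = B.repr (B j) k +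
      (B.repr (y 0) k * gram σ B 0 j + B.repr (y 1) k * gram σ B 1 j) := by
    intro k j
    -- For αδ - βγ = 1 one has αδ'w + βγ'w' - w = β Tr(γw) + α Tr(δw') - αδ Tr(w). So the central
    -- block minus the identity is an integral multiple of S, and y collects the coefficients.
    have e : L 0 0 * conjInt σ (L 1 1) * B j + L 0 1 * conjInt σ (L 1 0) * conjInt σ (B j) =
        B j + (gram σ B 0 j • y 0 + gram σ B 1 j • y 1) := by
      have s1 := sum_repr_mul_gram B hK hσ (conjInt σ (L 1 0)) j
      have s2 := sum_repr_mul_gram B hK hσ (L 1 1) j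
      have s3 := sum_repr_mul_gram B hK hσ 1 j
      rw [conjInt_conjInt hK hσ] at s1
      rw [map_one (conjInt σ)] at s3
      rw [det_fin_two] at hd
      simp only [hy, zsmul_eq_mul]
      linear_combination -L 0 1 * s1 - L 0 0 * s2 + L 0 0 * L 1 1 * s3 + B j * hd
    have e2 : (U (![1, 2] k) (![1, 2] j) : ℚ) =
        coords B ((L 0 0 * conjInt σ (L 1 1) * B j +
          L 0 1 * conjInt σ (L 1 0) * conjInt σ (B j) : 𝓞 K) : K) k := by
      have e3 : endoMat σ B ((L 0 0 : K) * σ (L 1 1 : K) / ((1 : ℕ) : K))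
          ((L 0 1 : K) * σ (L 1 0 : K) / ((1 : ℕ) : K)) k j =
          coords B ((L 0 0 * conjInt σ (L 1 1) * B j +
          L 0 1 * conjInt σ (L 1 0) * conjInt σ (B j) : 𝓞 K) : K) k := by
        have e5 : ((L 0 0 * conjInt σ (L 1 1) * B j +
            L 0 1 * conjInt σ (L 1 0) * conjInt σ (B j) : 𝓞 K) : K) =
            (L 0 0 : K) * σ (L 1 1 : K) * (B j : K) +
              (L 0 1 : K) * σ (L 1 0 : K) * σ (B j : K) := rfl
        rw [e5]
        simp [endoMat, LinearMap.toMatrix_apply, coords, ratBasis_apply, mul_assoc]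
      rw [h, ← e3]
      fin_cases k <;> fin_cases j <;> simp [tildeMat]
    rw [coords_int, e] at e2
    have e4 : U (![1, 2] k) (![1, 2] j) = B.repr (B j + (gram σ B 0 j • y 0 + gram σ B 1 j • y 1)) k := by
      exact_mod_cast e2
    rw [e4]
    simp only [map_add, map_zsmul, Finsupp.add_apply, Finsupp.smul_apply, smul_eq_mul]
    ring
  -- Right multiplication by `S₁` exchanges the outer columns, so the outer columns of X are those
  -- of U - 1 in reverse order.
  refine ⟨!![U 0 3, B.repr a 0, B.repr a 1, U 0 0 - 1;
    U 1 3, B.repr (y 0) 0, B.repr (y 1) 0, U 1 0;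
    U 2 3, B.repr (y 0) 1, B.repr (y 1) 1, U 2 0;
    U 3 3 - 1, B.repr d 0, B.repr d 1, U 3 0], ?_⟩
  have r00 := r0 0
  have r01 := r0 1
  have r30 := r3 0
  have r31 := r3 1
  have c00 := rc 0 0
  have c01 := rc 0 1
  have c10 := rc 1 0
  have c11 := rc 1 1
  simp at r00 r01 r30 r31 c00 c01 c10 c11
  ext i j
  fin_cases i <;> fin_cases j <;>
    simp [hyp, r00, r01, r30, r31, c00, c01, c10, c11]

/-- The ring of integers is generated by one element as a ring; `ν` and `lam` are the coordinates. -/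
lemma exists_integral_generator (B : Module.Basis (Fin 2) ℤ (𝓞 K)) : ∃ (ω : 𝓞 K) (ν lam : 𝓞 K →ₗ[ℤ] ℤ),
    (∀ x, x = ν x + lam x * ω) ∧ ν 1 = 1 ∧ lam ω = 1 := by
  set p := B.repr 1 0 with hp
  set q := B.repr 1 1 with hq
  have h1 : (p : 𝓞 K) * B 0 + (q : 𝓞 K) * B 1 = 1 := repr_sum B 1
  -- The gcd of the coordinates of 1 divides 1 in the ring of integers, so its norm, the square of
  -- the gcd, is a unit.
  have hg : IsCoprime p q := by
    rw [Int.isCoprime_iff_gcd_eq_one]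
    obtain ⟨p', hp'⟩ := Int.gcd_dvd_left p q
    obtain ⟨q', hq'⟩ := Int.gcd_dvd_right p q
    have hu : ((Int.gcd p q : ℤ) : 𝓞 K) * (p' * B 0 + q' * B 1) = 1 := by
      calc ((Int.gcd p q : ℤ) : 𝓞 K) * (p' * B 0 + q' * B 1)
          = ((Int.gcd p q * p' : ℤ) : 𝓞 K) * B 0 + ((Int.gcd p q * q' : ℤ) : 𝓞 K) * B 1 := by
            push_cast
            ring
        _ = 1 := by rw [← hp', ← hq', h1]
    have hn := congrArg (Algebra.norm ℤ) hu
    rw [map_mul, map_one (Algebra.norm ℤ)] at hn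
    have hu' : IsUnit (Algebra.norm ℤ ((Int.gcd p q : ℤ) : 𝓞 K)) := IsUnit.of_mul_eq_one _ hn
    have e := Algebra.norm_algebraMap_of_basis B (Int.gcd p q : ℤ)
    rw [eq_intCast, Fintype.card_fin] at e
    rw [e, isUnit_pow_iff two_ne_zero, Int.isUnit_iff] at hu'
    omega
  obtain ⟨s, t, hst⟩ := hg
  have r0 : ∀ a b : ℤ, B.repr (a * B 0 + b * B 1 : 𝓞 K) 0 = a := by
    intro a b
    rw [← zsmul_eq_mul, ← zsmul_eq_mul, map_add, map_zsmul, map_zsmul]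
    simp
  have r1 : ∀ a b : ℤ, B.repr (a * B 0 + b * B 1 : 𝓞 K) 1 = b := by
    intro a b
    rw [← zsmul_eq_mul, ← zsmul_eq_mul, map_add, map_zsmul, map_zsmul]
    simp
  -- The Bézout coefficients complete 1 to a basis (1, ω), and `ν`, `lam` are the coordinates in it.
  refine ⟨((-t : ℤ) : 𝓞 K) * B 0 + (s : 𝓞 K) * B 1, s • B.coord 0 + t • B.coord 1,
    p • B.coord 1 - q • B.coord 0, ?_, ?_, ?_⟩
  · intro x
    have hx := repr_sum B x
    have hst' : (s : 𝓞 K) * p + t * q = 1 := by exact_mod_cast congrArg (Int.cast : ℤ → 𝓞 K) hst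
    simp only [LinearMap.add_apply, LinearMap.sub_apply, LinearMap.smul_apply,
      Module.Basis.coord_apply, smul_eq_mul]
    push_cast
    linear_combination -(s * p + t * q) * hx - (s * B.repr x 0 + t * B.repr x 1 : 𝓞 K) * (-h1) - x * (hst')
  · simp [← hp, ← hq]
    linear_combination hst
  · simp only [LinearMap.sub_apply, LinearMap.smul_apply, Module.Basis.coord_apply, smul_eq_mul, r0,
      r1]
    linear_combination hst

lemma generator_ne_conj (hσ : σ ≠ 1) {ω : 𝓞 K} {ν lam : 𝓞 K →ₗ[ℤ] ℤ}
    (hx : ∀ x, x = ν x + lam x * ω) : (ω : K) ≠ σ (ω : K) := by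
  intro h
  apply hσ
  have hB : ∀ x : 𝓞 K, σ (x : K) = x := by
    intro x
    rw [hx x]
    simp [← h]
  ext x
  obtain ⟨a, b, -, rfl⟩ := IsFractionRing.div_surjective (A := 𝓞 K) x
  rw [map_div₀, AlgEquiv.one_apply]
  exact congrArg₂ _ (hB a) (hB b)

/-- The congruence satisfied by the entries of `L` if `M̃` belongs to the discriminant kernel. -/
lemma dvd_of_eq_one_add_mul (hK : Module.finrank ℚ K = 2) (hσ : σ ≠ 1) {ω : 𝓞 K}
    {ν lam : 𝓞 K →ₗ[ℤ] ℤ} (hx : ∀ x, x = ν x + lam x * ω) {ℓ : ℕ} (hℓ : 0 < ℓ)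
    {L : Matrix (Fin 2) (Fin 2) (𝓞 K)} (hd : L.det = ℓ) {U X : Matrix (Fin 4) (Fin 4) ℤ}
    (hU : U.map (Int.cast : ℤ → ℚ) = tildeMat σ B ℓ L) (hX : U = 1 + X * hyp (gram σ B)) :
    (ℓ : 𝓞 K) ∣ L 0 0 * lam (L 1 1) - L 0 1 * lam (L 1 0) := by
  have hℓ' : (ℓ : K) ≠ 0 := Nat.cast_ne_zero.mpr hℓ.ne'
  set p : K := (L 0 0 : K) * σ (L 1 1 : K) / (ℓ : K) with hp
  set q : K := (L 0 1 : K) * σ (L 1 0 : K) / (ℓ : K) with hq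
  set y₀ : 𝓞 K := X 1 1 * B 0 + X 2 1 * B 1 with hy₀
  set y₁ : 𝓞 K := X 1 2 * B 0 + X 2 2 * B 1 with hy₁
  have c0 := central_col B hU 0
  have c1 := central_col B hU 1
  rw [← hp, ← hq, hX] at c0 c1
  simp [hyp, Matrix.mul_apply, Fin.sum_univ_succ, gram_cast B hK hσ] at c0 c1
  -- The congruence for the central block says that r w + s w' vanishes at both basis vectors, and u
  -- v' - v u' ≠ 0 gives r = s = 0.
  set r : K := p - 1 - (y₀ * σ (B 0 : K) + y₁ * σ (B 1 : K)) with hr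
  set s : K := q - (y₀ * (B 0 : K) + y₁ * (B 1 : K)) with hs
  have e0 : r * (B 0 : K) + s * σ (B 0 : K) = 0 := by
    simp [hr, hs, hy₀, hy₁]
    linear_combination c0
  have e1 : r * (B 1 : K) + s * σ (B 1 : K) = 0 := by
    simp [hr, hs, hy₀, hy₁]
    linear_combination c1
  have hdet := conj_sub_ne_zero B hK hσ
  have hr0 : r = 0 := by
    refine (mul_eq_zero.mp ?_).resolve_right hdet
    linear_combination σ (B 1 : K) * e0 - σ (B 0 : K) * e1
  have hs0 : s = 0 := by
    refine (mul_eq_zero.mp ?_).resolve_right hdet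
    linear_combination (B 0 : K) * e1 - (B 1 : K) * e0
  -- Since det L = ℓ, ℓ(p - 1 - q) = α(δ' - δ) - β(γ' - γ). Every difference x' - x is -lam(x)(ω -
  -- ω'), and dividing by ω - ω' leaves the divisibility.
  have hpq : p - 1 - q = (y₀ : K) * (σ (B 0 : K) - B 0) + y₁ * (σ (B 1 : K) - B 1) := by
    linear_combination hr0 - hs0
  have hω := sub_ne_zero.mpr (generator_ne_conj hσ hx)
  have hdiff : ∀ x : 𝓞 K, σ (x : K) - x = -(lam x : K) * ((ω : K) - σ (ω : K)) := by
    intro x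
    have h1 : (x : K) = ν x + lam x * ω := by
      conv_lhs => rw [hx x]
      simp
    have h2 := congrArg σ h1
    simp at h2
    linear_combination h2 - h1
  rw [det_fin_two] at hd
  have hd' : (L 0 0 : K) * L 1 1 - L 0 1 * L 1 0 = ℓ := by
    have := congrArg (fun x : 𝓞 K => (x : K)) hd
    simpa using this
  refine ⟨y₀ * lam (B 0) + y₁ * lam (B 1), RingOfIntegers.ext ?_⟩
  have hpℓ : p * ℓ = (L 0 0 : K) * σ (L 1 1 : K) := div_mul_cancel₀ _ hℓ'
  have hqℓ : q * ℓ = (L 0 1 : K) * σ (L 1 0 : K) := div_mul_cancel₀ _ hℓ'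
  have hfin : ((L 0 0 : K) * lam (L 1 1) - L 0 1 * lam (L 1 0)) * ((ω : K) - σ (ω : K)) =
      ℓ * (y₀ * lam (B 0) + y₁ * lam (B 1)) * ((ω : K) - σ (ω : K)) := by
    linear_combination (L 0 0 : K) * hdiff (L 1 1) - (L 0 1 : K) * hdiff (L 1 0) + hpℓ - hqℓ
      - ℓ * hpq - ℓ * y₀ * hdiff (B 0) - ℓ * y₁ * hdiff (B 1) + hd'
  have := mul_right_cancel₀ hω hfin
  simpa using this

/-- A primitive matrix satisfying the congruence of the discriminant kernel has determinant one. -/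
lemma eq_one_of_primitive {ω : 𝓞 K}
    {ν lam : 𝓞 K →ₗ[ℤ] ℤ} (hx : ∀ x, x = ν x + lam x * ω) (hν : ν 1 = 1)
    (hω : lam ω = 1)    {ℓ : ℕ} {L : Matrix (Fin 2) (Fin 2) (𝓞 K)} (hd : L.det = ℓ)
    (hI : entryIdeal L ^ 2 = Ideal.span {(ℓ : 𝓞 K)})
    (hdvd : (ℓ : 𝓞 K) ∣ L 0 0 * lam (L 1 1) - L 0 1 * lam (L 1 0))
    (hprim : ∀ g : ℤ, (∀ i j, (g : 𝓞 K) ∣ L i j) → IsUnit g) : ℓ = 1 := by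
  have hlm : ∀ (n : ℤ) (x : 𝓞 K), lam (n * x) = n * lam x := by
    intro n x
    rw [← zsmul_eq_mul, map_zsmul, smul_eq_mul]
  -- The image lam(I) is an ideal gℤ. Testing x and ωx for each entry x shows that g divides both
  -- coordinates of x, so primitivity makes g a unit.
  obtain ⟨π, hπ, hlπ⟩ : ∃ π ∈ entryIdeal L, lam π = 1 := by
    set J : Submodule ℤ ℤ := ((entryIdeal L).restrictScalars ℤ).map lam with hJ
    obtain ⟨g, hg⟩ := IsPrincipalIdealRing.principal J
    have hgl : ∀ x ∈ entryIdeal L, g ∣ lam x := by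
      intro x hx
      have : lam x ∈ J := ⟨x, hx, rfl⟩
      rw [hg] at this
      exact Ideal.mem_span_singleton.mp this
    have hu : IsUnit g := by
      apply hprim
      intro i j
      have h1 := hgl _ (entry_mem L i j)
      have h2 := hgl _ (Ideal.mul_mem_left _ ω (entry_mem L i j))
      have h3 : ω * L i j = (ν (L i j) : 𝓞 K) * ω + (lam (L i j) : 𝓞 K) * (ω * ω) := by
        conv_lhs => rw [hx (L i j)]
        ring
      have h4 : g ∣ ν (L i j) := by
        rw [h3, map_add, hlm, hlm, hω, mul_one] at h2
        exact (dvd_add_left (dvd_mul_of_dvd_left h1 _)).mp h2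
      rw [hx (L i j)]
      exact dvd_add (map_dvd (Int.castRingHom (𝓞 K)) h4)
        (dvd_mul_of_dvd_left (map_dvd (Int.castRingHom (𝓞 K)) h1) _)
    have : (1 : ℤ) ∈ J := by
      rw [hg]
      exact Ideal.mem_span_singleton.mpr hu.dvd
    obtain ⟨π, hπ, h⟩ := this
    exact ⟨π, hπ, h⟩
  -- nπ lies in I² = (ℓ), and its `lam`-coordinate is n.
  have hmem : ∀ n : ℤ, (n : 𝓞 K) ∈ entryIdeal L → (ℓ : 𝓞 K) ∣ n := by
    intro n hn
    have h1 : (n : 𝓞 K) * π ∈ entryIdeal L ^ 2 := by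
      rw [pow_two]
      exact Ideal.mul_mem_mul hn hπ
    rw [hI, Ideal.mem_span_singleton] at h1
    obtain ⟨w, hw⟩ := h1
    have h2 := congrArg lam hw
    rw [hlm, hlπ, mul_one, ← Int.cast_natCast, hlm] at h2
    rw [h2]
    push_cast
    exact dvd_mul_right _ _
  -- Subtracting lam(x) π leaves an integer in I, which ℓ divides.
  have hdec : ∀ x ∈ entryIdeal L, ∃ z : 𝓞 K, x = ℓ * z + lam x * π := by
    intro x hxI
    have h1 : x - lam x * π = (ν (x - lam x * π) : ℤ) := by
      conv_lhs => rw [hx (x - lam x * π)]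
      rw [map_sub lam, hlm, hlπ]
      simp
    obtain ⟨z, hz⟩ := hmem (ν (x - lam x * π)) (by
      rw [← h1]
      exact sub_mem hxI (Ideal.mul_mem_left _ _ hπ))
    exact ⟨z, by linear_combination h1 + hz⟩
  have hℓ0 : (ℓ : 𝓞 K) ≠ 0 := by
    intro h0
    have : ℓ = 0 := by exact_mod_cast h0
    rw [h0, Ideal.span_singleton_eq_bot.mpr rfl, ← Ideal.zero_eq_bot, pow_eq_zero_iff two_ne_zero,
      Ideal.zero_eq_bot] at hI
    rw [hI, Submodule.mem_bot] at hπ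
    rw [hπ, map_zero] at hlπ
    exact zero_ne_one hlπ
  obtain ⟨a, ha⟩ := hdec _ (entry_mem L 1 1)
  obtain ⟨b, hb⟩ := hdec _ (entry_mem L 1 0)
  obtain ⟨y, hy⟩ := hdvd
  -- Insert the decompositions of γ and δ into ℓ = αδ - βγ and divide by ℓ; this exhibits 1 in I(L).
  have h1 : (1 : 𝓞 K) = L 0 0 * a - L 0 1 * b + y * π := by
    refine mul_left_cancel₀ hℓ0 ?_
    rw [det_fin_two] at hd
    linear_combination -hd + L 0 0 * ha - L 0 1 * hb + π * hy
  have h2 : entryIdeal L = ⊤ := by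
    rw [Ideal.eq_top_iff_one, h1]
    exact add_mem (sub_mem (Ideal.mul_mem_right _ _ (entry_mem L 0 0))
      (Ideal.mul_mem_right _ _ (entry_mem L 0 1))) (Ideal.mul_mem_left _ _ hπ)
  rw [h2, Ideal.top_pow, eq_comm, Ideal.span_singleton_eq_top] at hI
  obtain ⟨w, hw⟩ := hI.exists_right_inv
  have h3 := congrArg ν hw
  rw [hν, ← Int.cast_natCast, ← zsmul_eq_mul, map_zsmul, smul_eq_mul] at h3
  have := Int.isUnit_iff.mp (IsUnit.of_mul_eq_one _ h3)
  omega

end Discriminant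

/-! ### Surjectivity onto the discriminant kernel -/

section Discriminant

variable {K : Type*} [Field K] [NumberField K] {σ : K ≃ₐ[ℚ] K}
  (B : Module.Basis (Fin 2) ℤ (𝓞 K))

/-- Every element of the discriminant kernel comes from `SL_2(𝓞 K)`. -/
lemma exists_of_eq_one_add_mul (hK : Module.finrank ℚ K = 2) (hσ : σ ≠ 1) {ι : K →+* ℝ}
    {M : Matrix.SpecialLinearGroup (Fin 2) ℝ} {U : Matrix.SpecialLinearGroup (Fin 4) ℤ}
    {X : Matrix (Fin 4) (Fin 4) ℤ} (hX : U.1 = 1 + X * hyp (gram σ B)) (ℓ : ℕ) :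
    ∀ L : Matrix (Fin 2) (Fin 2) (𝓞 K), IsRep ι M ℓ L →
      U.1.map (Int.cast : ℤ → ℚ) = tildeMat σ B ℓ L →
      ∃ N : Matrix.SpecialLinearGroup (Fin 2) (𝓞 K),
        U.1.map (Int.cast : ℤ → ℚ) = tildeMat σ B 1 N := by
  induction ℓ using Nat.strong_induction_on with
  | _ ℓ ih =>
  intro L h hU
  have hd := det_of_isRep h
  obtain ⟨ω, ν, lam, hx, hν, hω⟩ := exists_integral_generator B
  by_cases hprim : ∀ g : ℤ, (∀ i j, (g : 𝓞 K) ∣ L i j) → IsUnit g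
  · have hI := sq_eq_of_conjDvd hK hσ h.1 hd (conjDvd_of_int B hK hσ h.1 hd U hU)
    have hdvd := dvd_of_eq_one_add_mul B hK hσ hx h.1 hd hU hX
    have h1 : ℓ = 1 := eq_one_of_primitive hx hν hω hd hI hdvd hprim
    subst h1
    exact ⟨⟨L, by rw [hd, Nat.cast_one]⟩, hU⟩
  -- A common integer factor g of L is removed: ℓ = g² k with k < ℓ, and neither M nor M̃ changes.
  · push Not at hprim
    obtain ⟨g', hg', hgu⟩ := hprim
    obtain ⟨g, hg, hg1⟩ : ∃ g : ℕ, (∀ i j, (g : 𝓞 K) ∣ L i j) ∧ g ≠ 1 := by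
      refine ⟨g'.natAbs, fun i j => ?_, fun h1 => hgu (Int.isUnit_iff_natAbs_eq.mpr h1)⟩
      rcases Int.natAbs_eq g' with e | e
      · have := hg' i j
        rwa [e, Int.cast_natCast] at this
      · have := hg' i j
        rwa [e, Int.cast_neg, Int.cast_natCast, neg_dvd] at this
    choose P hP using hg
    have hLP : L = (g : 𝓞 K) • Matrix.of P := by
      apply Matrix.ext
      intro i j
      exact hP i j
    have hdP : (g : 𝓞 K) ^ 2 * (Matrix.of P).det = ℓ := by
      rw [← hd, hLP, det_smul, Fintype.card_fin]
    have hℓ0 : (ℓ : 𝓞 K) ≠ 0 := Nat.cast_ne_zero.mpr h.1.ne'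
    have hg0 : g ≠ 0 := by
      rintro rfl
      rw [Nat.cast_zero, zero_pow two_ne_zero, zero_mul] at hdP
      exact hℓ0 hdP.symm
    have hgK : (g : K) ≠ 0 := Nat.cast_ne_zero.mpr hg0
    have hdPK : (g : K) ^ 2 * ((Matrix.of P).det : K) = ℓ := by
      have := congrArg (fun x : 𝓞 K => (x : K)) hdP
      simpa using this
    obtain ⟨m, hm⟩ := exists_int_of_conj_eq hK hσ (x := (Matrix.of P).det) (by
      have h1 := congrArg σ hdPK
      rw [map_mul, map_pow, map_natCast, map_natCast, ← hdPK] at h1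
      exact mul_left_cancel₀ (pow_ne_zero 2 hgK) h1)
    have hmℓ : (g : ℤ) ^ 2 * m = ℓ := by
      rw [hm] at hdP
      exact_mod_cast hdP
    have hm0 : 0 < m := by
      have h1 : 0 < (g : ℤ) ^ 2 * m := by
        rw [hmℓ]
        exact_mod_cast h.1
      exact pos_of_mul_pos_right h1 (by positivity)
    lift m to ℕ using hm0.le with k
    have hk0 : 0 < k := by exact_mod_cast hm0
    have hkℓ : ℓ = g ^ 2 * k := by exact_mod_cast hmℓ.symm
    have hlt : k < ℓ := by
      have : 2 ≤ g := by omega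
      rw [hkℓ]
      exact lt_mul_of_one_lt_left hk0 (one_lt_pow₀ this two_ne_zero)
    refine ih k hlt (Matrix.of P) ⟨hk0, ?_⟩ ?_
    · have hgR : (0 : ℝ) < g := by exact_mod_cast Nat.pos_of_ne_zero hg0
      rw [h.2, hkℓ, hLP]
      push_cast
      rw [Real.sqrt_mul (by positivity), Real.sqrt_sq hgR.le]
      ext i j
      simp [realMat]
      field_simp
    · rw [hU, hkℓ, hLP]
      have := tildeMat_mul B hK hσ (g ^ 2) k ((g : 𝓞 K) • (1 : Matrix (Fin 2) (Fin 2) (𝓞 K)))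
        (Matrix.of P)
      rwa [tildeMat_scalar B hK hσ (Nat.pos_of_ne_zero hg0), Matrix.one_mul, Matrix.smul_mul,
        Matrix.one_mul] at this

/-- The isomorphism of the Hilbert modular group modulo signs with the discriminant kernel. -/
theorem exists_mulEquiv_discKernel (hK : Module.finrank ℚ K = 2) (hσ : σ ≠ 1) (ι : K →+* ℝ) :
    ∃ χ : Matrix.SpecialLinearGroup (Fin 2) (𝓞 K) ⧸ pmOne 2 (𝓞 K) ≃* discKernel (hyp (gram σ B)),
      ∀ M : Matrix.SpecialLinearGroup (Fin 2) (𝓞 K),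
        ((χ (QuotientGroup.mk M) : Matrix.SpecialLinearGroup (Fin 4) ℤ) :
          Matrix (Fin 4) (Fin 4) ℤ).map (Int.cast : ℤ → ℚ) = tildeMat σ B 1 M := by
  have hrep : ∀ M : Matrix.SpecialLinearGroup (Fin 2) (𝓞 K),
      IsRep ι (Matrix.SpecialLinearGroup.map (ι.comp (algebraMap (𝓞 K) K)) M) 1 M.1 := by
    intro M
    refine ⟨one_pos, ?_⟩
    simp
    rfl
  have tot : ∀ M : Matrix.SpecialLinearGroup (Fin 2) (𝓞 K), ∃ U : discKernel (hyp (gram σ B)),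
      U.1.1.map (Int.cast : ℤ → ℚ) = tildeMat σ B 1 M.1 := by
    intro M
    obtain ⟨U, hU⟩ := exists_mem_SO0Int B hK hσ (hrep M) (fun i j k l => by simp)
    exact ⟨⟨U.1, U.2, exists_eq_one_add_mul B hK hσ M.2 hU⟩, hU⟩
  -- With ℓ = 1 fixed, M̃ is a function of M, so no sign is divided out in the target; its kernel
  -- consists of the scalars ±1.
  obtain ⟨χ, hχ⟩ := exists_mulEquiv_of_rel (pmOne 2 (𝓞 K)) (⊥ : Subgroup (discKernel (hyp (gram σ B))))
    (fun M U => U.1.1.map (Int.cast : ℤ → ℚ) = tildeMat σ B 1 M.1) tot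
    (by
      rintro ⟨U, hU, X, hX⟩
      obtain ⟨M, ℓ, L, h, e⟩ := exists_isRep_of_mem_SO0Int B hK hσ ι hU
      exact exists_of_eq_one_add_mul B hK hσ hX ℓ L h e)
    (by
      intro M U N V hU hV
      have h1 := tildeMat_mul B hK hσ 1 1 M.1 N.1
      rw [one_mul, ← hU, ← hV] at h1
      refine Eq.trans ?_ h1.symm
      exact Matrix.map_mul (f := Int.castRingHom ℚ))
    (by
      intro M U hU
      have e := tildeMat_eq_smul_one_iff B hK hσ one_pos M.1 (ε := 1) one_ne_zero
      rw [one_smul, ← hU] at e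
      have hinj := Matrix.map_injective (m := Fin 4) (n := Fin 4) (Int.cast_injective (α := ℚ))
      have hb : U ∈ (⊥ : Subgroup (discKernel (hyp (gram σ B)))) ↔
          U.1.1.map (Int.cast : ℤ → ℚ) = 1 := by
        have h1 : (1 : Matrix (Fin 4) (Fin 4) ℤ).map (Int.cast : ℤ → ℚ) = 1 := by simp
        rw [Subgroup.mem_bot, ← h1, hinj.eq_iff]
        exact ⟨fun h => by rw [h]; rfl, fun h => Subtype.ext (Subtype.ext h)⟩
      rw [hb, e]
      change M.1 = 1 ∨ M.1 = -1 ↔ _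
      constructor
      · rintro (h | h) <;> simp [h]
      · rintro ⟨h1, h2, h3, -⟩
        have hd := M.2
        rw [det_fin_two, h1, h2, ← h3] at hd
        have : (M.1 0 0 - 1) * (M.1 0 0 + 1) = 0 := by linear_combination hd
        rcases mul_eq_zero.mp this with h4 | h4
        · left
          have h5 : M.1 0 0 = 1 := by linear_combination h4
          apply Matrix.ext
          intro i j
          fin_cases i <;> fin_cases j <;> simp [h1, h2, ← h3, h5]
        · right
          have h5 : M.1 0 0 = -1 := by linear_combination h4
          apply Matrix.ext
          intro i j
          fin_cases i <;> fin_cases j <;> simp [h1, h2, ← h3, h5])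
  refine ⟨χ.trans QuotientGroup.quotientBot, fun M => ?_⟩
  obtain ⟨U, hU⟩ := tot M
  rw [MulEquiv.trans_apply, hχ M U hU]
  exact hU

end Discriminant

end HilbertOrth

theorem theorem2 {K : Type*} [Field K] [NumberField K] (hK : Module.finrank ℚ K = 2)
    (ι : K →+* ℝ) (σ : K ≃ₐ[ℚ] K) (hσ : σ ≠ 1) (B : Module.Basis (Fin 2) ℤ (𝓞 K)) :
    -- `M̃` arises from `Ω(M, M')` by the base change, `M' = (1 / √ℓ) L'`
    (∀ (M : Matrix.SpecialLinearGroup (Fin 2) ℝ) (ℓ : ℕ) (L : Matrix (Fin 2) (Fin 2) (𝓞 K)),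
      IsRep ι M ℓ L →
        IsUnit (hatG ι σ B).det ∧
        (tildeMat σ B ℓ L).map (Rat.cast : ℚ → ℝ) =
          (hatG ι σ B)⁻¹ *
            Omega M ((1 / √(ℓ : ℝ)) • realMat (ι.comp (σ : K →+* K)) L) * hatG ι σ B) ∧
    -- `Σ_K / {± I} ≅ SO_0(S_1; ℚ) / {± I}` via `± M ↦ ± M̃`
    (∃ φ : ModPm (SigmaGroup ι) ≃* ModPm (SO0Rat (hyp (gram σ B))),
      ∀ (M : SigmaGroup ι) (ℓ : ℕ) (L : Matrix (Fin 2) (Fin 2) (𝓞 K)), IsRep ι M ℓ L →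
        ∃ U : SO0Rat (hyp (gram σ B)),
          ((U : Matrix.SpecialLinearGroup (Fin 4) ℚ) : Matrix (Fin 4) (Fin 4) ℚ) = tildeMat σ B ℓ L ∧
          φ (QuotientGroup.mk M) = QuotientGroup.mk U) ∧
    -- `Γ*_K / {± I} ≅ SO_0(S_1; ℤ) / {± I}` via `± M ↦ ± M̃`
    (HurwitzMaass ι σ ≤ SigmaGroup ι ∧
      ∃ ψ : ModPm (HurwitzMaass ι σ) ≃* ModPm (SO0Int (hyp (gram σ B))),
        ∀ (M : HurwitzMaass ι σ) (ℓ : ℕ) (L : Matrix (Fin 2) (Fin 2) (𝓞 K)), IsRep ι M ℓ L →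
          ∃ U : SO0Int (hyp (gram σ B)),
            ((U : Matrix.SpecialLinearGroup (Fin 4) ℤ) : Matrix (Fin 4) (Fin 4) ℤ).map
              (Int.cast : ℤ → ℚ) = tildeMat σ B ℓ L ∧
            ψ (QuotientGroup.mk M) = QuotientGroup.mk U) ∧
    -- `SL_2(𝓞 K) / {± I} ≅ D(S_1; ℤ)` via `± M ↦ M̃`
    (∃ χ : Matrix.SpecialLinearGroup (Fin 2) (𝓞 K) ⧸ pmOne 2 (𝓞 K) ≃* discKernel (hyp (gram σ B)),
      ∀ M : Matrix.SpecialLinearGroup (Fin 2) (𝓞 K),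
        ((χ (QuotientGroup.mk M) : Matrix.SpecialLinearGroup (Fin 4) ℤ) :
          Matrix (Fin 4) (Fin 4) ℤ).map (Int.cast : ℤ → ℚ) = tildeMat σ B 1 M) := by
  refine ⟨fun M ℓ L h => ⟨isUnit_det_hatG B hK hσ ι, ?_⟩, exists_mulEquiv_SO0Rat B hK hσ ι,
    ⟨HurwitzMaass_le_SigmaGroup hK hσ ι, exists_mulEquiv_SO0Int B hK hσ ι⟩,
    exists_mulEquiv_discKernel B hK hσ ι⟩
  rw [Omega_eq_tens, h.2, Matrix.mul_assoc, ← hatG_mul_tildeMat B hK hσ, ← Matrix.mul_assoc,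
    nonsing_inv_mul _ (isUnit_det_hatG B hK hσ ι), Matrix.one_mul]
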